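/- Let $M$ be a smooth ($C^\infty$, Hausdorff, second countable) manifold of dimension $2n$ and let $\omega_1,\omega_2$ be two symplectic forms on $M$. For a symplectic form $\omega$ write $\omega^\flat\colon TM\to T^*M$, $v\mapsto\omega(v,\cdot)$, and $\omega^\sharp=(\omega^\flat)^{-1}\colon T^*M\to TM$ (the Poisson tensor of $\omega$). Assume that $\omega_1,\omega_2$ are Magri-compatible, i.e. $\omega_1^\sharp+\omega_2^\sharp$ is again a Poisson tensor. Let $N=\omega_2^\sharp\omega_1^\flat\colon TM\to TM$ be the recursion operator, and assume that every point $p\in M$ is regular: on a neighbourhood of $p$ there are smooth real functions $\lambda_1,\dots,\lambda_n$ whose values at each point are $n$ distinct eigenvalues of $N$, and $d\lambda_1,\dots,d\lambda_n$ are linearly independent at $p$. Put $I_k=\frac1k\operatorname{Tr}(N^k)$. (1) The functions $I_1,\dots,I_n$ have linearly independent differentials at every point, and the distribution $L=\bigcap_{k=1}^n\ker dI_k$ is involutive and Lagrangian with respect to both $\omega_1$ and $\omega_2$; so the $I_k$ define a bi-Lagrangian foliation of $M$. (2) The Bott connections of $\omega_1$ and $\omega_2$ in $L$ coincide: for all smooth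 vector fields $X,Y$ tangent to $L$, $$\omega_1^\sharp\,\mathcal L_X(\omega_1^\flat Y)=\omega_2^\sharp\,\mathcal L_X(\omega_2^\flat Y).$$ (3) If the foliation is a fibration with compact connected fibers, i.e. there is a smooth locally trivial fibration $\pi\colon M\to B$ with compact connected fibers onto an $n$-dimensional manifold with $\ker d\pi=L$, then $\omega_1$ and $\omega_2$ are bi-affinely compatible; more precisely they are $\pi$-compatible for every such $\pi$. Here $\omega_1,\omega_2$ are called $\pi$-compatible if $\pi$ is a smooth fibration with compact connected fibers that are Lagrangian for both forms, and the Bott connections $\nabla_XY=\omega_i^\sharp\mathcal L_X(\omega_i^\flat Y)$, $X,Y$ tangent to the fibers, coincide for $i=1,2$; and bi-affinely compatible if they are $\pi$-compatible for some $\pi$. -/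

import Mathlib

open Set Filter Topology Bundle Manifold
open scoped ContDiff

universe u v

noncomputable section

namespace BiHam

section Basics

variable {d : ℕ} {M : Type u} [TopologicalSpace M] [ChartedSpace (EuclideanSpace ℝ (Fin d)) M]
  [IsManifold (𝓡 d) ∞ M]

/-- A vector field `X` on `M` (a function `x ↦ X x ∈ T_x M`) is smooth. -/
def SmoothField (X : Π x : M, TangentSpace (𝓡 d) x) : Prop :=
  ContMDiff (𝓡 d) ((𝓡 d).prod 𝓘(ℝ, EuclideanSpace ℝ (Fin d))) ∞
    (fun x ↦ TotalSpace.mk' (EuclideanSpace ℝ (Fin d)) x (X x))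

/-- A function on `M` is smooth. -/
def SmoothFun (f : M → ℝ) : Prop := ContMDiff (𝓡 d) 𝓘(ℝ, ℝ) ∞ f

/-- The differential of a function, as a `1`-form. -/
def diff (f : M → ℝ) (x : M) : TangentSpace (𝓡 d) x →L[ℝ] ℝ := mvfderiv (𝓡 d) f x

/-- The derivative `X[f]` of a function along a vector field. -/
def dirDeriv (X : Π x : M, TangentSpace (𝓡 d) x) (f : M → ℝ) (x : M) : ℝ :=
  diff f x (X x)

/-- The number `(L_X α)(Z) (x) = X[α(Z)](x) - α([X, Z])(x)`, for vector fields `X`, `Z` and a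
`1`-form `α`. -/
def lieDerivPairing (X : Π x : M, TangentSpace (𝓡 d) x)
    (α : Π x : M, TangentSpace (𝓡 d) x →L[ℝ] ℝ) (x : M)
    (Z : Π x : M, TangentSpace (𝓡 d) x) : ℝ :=
  dirDeriv X (fun y ↦ α y (Z y)) x - α x (VectorField.mlieBracket (𝓡 d) X Z x)

open Classical in
/-- The Lie derivative `L_X α` of a `1`-form along a vector field: the `1`-form with
`(L_X α)(Z) = X[α(Z)] - α([X, Z])` for all vector fields `Z`. It is obtained from the fact that the
right hand side at `x` only depends on `Z x`, which holds whenever `α` and `X` are smooth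
(`lieDeriv_apply` below); the junk value `0` is used only for non-smooth data. -/
def lieDeriv (X : Π x : M, TangentSpace (𝓡 d) x)
    (α : Π x : M, TangentSpace (𝓡 d) x →L[ℝ] ℝ) (x : M) : TangentSpace (𝓡 d) x →L[ℝ] ℝ :=
  if h : TensorialAt (𝓡 d) (EuclideanSpace ℝ (Fin d)) (lieDerivPairing X α x) x then
    TensorialAt.mkHom (lieDerivPairing X α x) x h
  else 0

/-- A `1`-form is smooth. -/
def SmoothOneForm (α : Π x : M, TangentSpace (𝓡 d) x →L[ℝ] ℝ) : Prop :=
  ContMDiff (𝓡 d) ((𝓡 d).prod 𝓘(ℝ, EuclideanSpace ℝ (Fin d) →L[ℝ] ℝ)) ∞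
    (fun x ↦ TotalSpace.mk' (EuclideanSpace ℝ (Fin d) →L[ℝ] ℝ)
      (E := fun x : M ↦ TangentSpace (𝓡 d) x →L[ℝ] ℝ) x (α x))

/-- The defining property of the Lie derivative of a smooth `1`-form along a smooth field. -/
theorem lieDeriv_apply {X : Π x : M, TangentSpace (𝓡 d) x}
    {α : Π x : M, TangentSpace (𝓡 d) x →L[ℝ] ℝ} (hX : SmoothField X) (hα : SmoothOneForm α)
    {Z : Π x : M, TangentSpace (𝓡 d) x} (hZ : SmoothField Z) (x : M) :
    lieDeriv X α x (Z x) =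
      dirDeriv X (fun y ↦ α y (Z y)) x - α x (VectorField.mlieBracket (𝓡 d) X Z x) := by
  have : IsManifold (𝓡 d) 2 M := inferInstance
  have hX' : MDifferentiableAt (𝓡 d) ((𝓡 d).prod 𝓘(ℝ, EuclideanSpace ℝ (Fin d)))
    (fun x ↦ TotalSpace.mk' (EuclideanSpace ℝ (Fin d)) x (X x)) x :=
    (hX x).mdifferentiableAt (by simp)
  have hα' := (hα x).mdifferentiableAt (by simp)
  have key : ∀ {Z : Π x : M, TangentSpace (𝓡 d) x},
      MDifferentiableAt (𝓡 d) ((𝓡 d).prod 𝓘(ℝ, EuclideanSpace ℝ (Fin d)))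
        (fun x ↦ TotalSpace.mk' (EuclideanSpace ℝ (Fin d)) x (Z x)) x →
      MDifferentiableAt (𝓡 d) 𝓘(ℝ, ℝ) (fun y ↦ α y (Z y)) x := by
    intro Z hZ
    have h := MDifferentiableAt.clm_bundle_apply (F₁ := EuclideanSpace ℝ (Fin d)) (F₂ := ℝ)
      (E₁ := fun x : M ↦ TangentSpace (𝓡 d) x) (E₂ := Bundle.Trivial M ℝ) hα' hZ
    exact (mdifferentiableAt_section (F := ℝ) (E := Bundle.Trivial M ℝ) _ _).1 h
  have hT : TensorialAt (𝓡 d) (EuclideanSpace ℝ (Fin d)) (lieDerivPairing X α x) x := by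
    constructor
    · intro f Z hf hZ
      have e : (fun y ↦ α y ((f • Z) y)) = fun y ↦ f y * α y (Z y) := by
        funext y; simp
      simp only [lieDerivPairing, dirDeriv, diff, e]
      rw [VectorField.mlieBracket_smul_right hf hZ, mvfderiv_fun_mul hf (key hZ)]
      simp
      ring
    · intro Z Z' hZ hZ'
      have e : (fun y ↦ α y ((Z + Z') y)) = fun y ↦ α y (Z y) + α y (Z' y) := by
        funext y; simp
      simp only [lieDerivPairing, dirDeriv, diff, e]
      rw [VectorField.mlieBracket_add_right hZ hZ', mvfderiv_fun_add (key hZ) (key hZ')]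
      simp
      ring
  rw [lieDeriv, dif_pos hT]
  exact TensorialAt.mkHom_apply hT ((hZ x).mdifferentiableAt (by simp))

/-- The exterior derivative `dΩ(X, Y, Z)` of a `2`-form, evaluated on three vector fields. -/
def extDerivTwo (Ω : Π x : M, TangentSpace (𝓡 d) x →L[ℝ] TangentSpace (𝓡 d) x →L[ℝ] ℝ)
    (X Y Z : Π x : M, TangentSpace (𝓡 d) x) (x : M) : ℝ :=
  dirDeriv X (fun y ↦ Ω y (Y y) (Z y)) x - dirDeriv Y (fun y ↦ Ω y (X y) (Z y)) x
    + dirDeriv Z (fun y ↦ Ω y (X y) (Y y)) x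
    - Ω x (VectorField.mlieBracket (𝓡 d) X Y x) (Z x)
    + Ω x (VectorField.mlieBracket (𝓡 d) X Z x) (Y x)
    - Ω x (VectorField.mlieBracket (𝓡 d) Y Z x) (X x)

variable (d M) in
/-- A symplectic form: a smooth, closed, nondegenerate `2`-form. The component `flat` is the musical
map `Ω♭ : T M → T* M`, `Ω♭ v = Ω(v, ·)`. -/
structure SymplecticForm where
  flat : Π x : M, TangentSpace (𝓡 d) x →L[ℝ] TangentSpace (𝓡 d) x →L[ℝ] ℝ
  alternating : ∀ (x : M) (v : TangentSpace (𝓡 d) x), flat x v v = 0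
  nondegenerate : ∀ (x : M) (v : TangentSpace (𝓡 d) x), (∀ w, flat x v w = 0) → v = 0
  smooth : ContMDiff (𝓡 d)
    ((𝓡 d).prod 𝓘(ℝ, EuclideanSpace ℝ (Fin d) →L[ℝ] EuclideanSpace ℝ (Fin d) →L[ℝ] ℝ)) ∞
    (fun x ↦ TotalSpace.mk' (EuclideanSpace ℝ (Fin d) →L[ℝ] EuclideanSpace ℝ (Fin d) →L[ℝ] ℝ)
      (E := fun x : M ↦ TangentSpace (𝓡 d) x →L[ℝ] TangentSpace (𝓡 d) x →L[ℝ] ℝ) x (flat x))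
  closed : ∀ X Y Z : Π x : M, TangentSpace (𝓡 d) x,
    SmoothField X → SmoothField Y → SmoothField Z → ∀ x, extDerivTwo flat X Y Z x = 0

/-- The inverse `Ω♯ : T* M → T M` of `Ω♭`. As a bundle map `T* M → T M`, it is the Poisson tensor
associated to `Ω`. -/
def SymplecticForm.sharp (Ω : SymplecticForm d M) (x : M) :
    (TangentSpace (𝓡 d) x →L[ℝ] ℝ) →L[ℝ] TangentSpace (𝓡 d) x :=
  (Ω.flat x).inverse

/-- The musical maps of a symplectic form are inverse to each other. -/
theorem SymplecticForm.exists_equiv (Ω : SymplecticForm d M) (x : M) :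
    ∃ e : TangentSpace (𝓡 d) x ≃L[ℝ] (TangentSpace (𝓡 d) x →L[ℝ] ℝ),
      (e : TangentSpace (𝓡 d) x →L[ℝ] (TangentSpace (𝓡 d) x →L[ℝ] ℝ)) = Ω.flat x ∧
      (e.symm : (TangentSpace (𝓡 d) x →L[ℝ] ℝ) →L[ℝ] TangentSpace (𝓡 d) x) = Ω.sharp x := by
  let A : EuclideanSpace ℝ (Fin d) →L[ℝ] (EuclideanSpace ℝ (Fin d) →L[ℝ] ℝ) := Ω.flat x
  have hinj : Function.Injective A.toLinearMap := by
    rw [← LinearMap.ker_eq_bot, LinearMap.ker_eq_bot']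
    intro v hv
    exact Ω.nondegenerate x v fun w ↦ congrArg (fun φ : EuclideanSpace ℝ (Fin d) →L[ℝ] ℝ ↦ φ w) hv
  have hdim : Module.finrank ℝ (EuclideanSpace ℝ (Fin d)) =
      Module.finrank ℝ (EuclideanSpace ℝ (Fin d) →L[ℝ] ℝ) :=
    (InnerProductSpace.toDual ℝ (EuclideanSpace ℝ (Fin d))).toLinearEquiv.finrank_eq
  let e : EuclideanSpace ℝ (Fin d) ≃L[ℝ] (EuclideanSpace ℝ (Fin d) →L[ℝ] ℝ) :=
    (LinearEquiv.ofInjectiveOfFinrankEq A.toLinearMap hinj hdim).toContinuousLinearEquiv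
  have he : (e : EuclideanSpace ℝ (Fin d) →L[ℝ] (EuclideanSpace ℝ (Fin d) →L[ℝ] ℝ)) = A := by
    ext v w; rfl
  refine ⟨e, he, ?_⟩
  have h2 : A.inverse = e.symm := by rw [← he]; exact ContinuousLinearMap.inverse_equiv e
  exact h2.symm

/-- The bracket `{f, g} = ⟨df, P(dg)⟩` of two functions defined by a bundle map
`P : T* M → T M`; for `P = Ω♯` it is `Ω(X_f, X_g)` with `X_f = Ω♯ df`. -/
def bracket (P : Π x : M, (TangentSpace (𝓡 d) x →L[ℝ] ℝ) →L[ℝ] TangentSpace (𝓡 d) x)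
    (f g : M → ℝ) (x : M) : ℝ :=
  diff f x (P x (diff g x))

/-- `P : T* M → T M` is a Poisson tensor: a smooth bivector field whose bracket satisfies the Jacobi
identity. -/
structure IsPoissonTensor
    (P : Π x : M, (TangentSpace (𝓡 d) x →L[ℝ] ℝ) →L[ℝ] TangentSpace (𝓡 d) x) : Prop where
  skew : ∀ (x : M) (α β : TangentSpace (𝓡 d) x →L[ℝ] ℝ), α (P x β) = - β (P x α)
  smooth : ∀ f g : M → ℝ, SmoothFun (d := d) f → SmoothFun (d := d) g →
    SmoothFun (d := d) (bracket P f g)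
  jacobi : ∀ f g h : M → ℝ, SmoothFun (d := d) f → SmoothFun (d := d) g → SmoothFun (d := d) h →
    ∀ x, bracket P f (bracket P g h) x + bracket P g (bracket P h f) x
      + bracket P h (bracket P f g) x = 0

/-- Magri compatibility: the sum of the Poisson tensors of the two forms is a Poisson tensor. -/
def MagriCompatible (ω₁ ω₂ : SymplecticForm d M) : Prop :=
  IsPoissonTensor (fun x ↦ ω₁.sharp x + ω₂.sharp x)

/-- The recursion operator `N = ω₂♯ ∘ ω₁♭ : T M → T M`. -/
def recursionOperator (ω₁ ω₂ : SymplecticForm d M) (x : M) :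
    Module.End ℝ (TangentSpace (𝓡 d) x) :=
  ((ω₂.sharp x).comp (ω₁.flat x)).toLinearMap

/-- The function `I_k = (1/k) Tr (N^k)` (for `k ≥ 1`). -/
def traceFun (ω₁ ω₂ : SymplecticForm d M) (k : ℕ) (x : M) : ℝ :=
  (1 / (k : ℝ)) * LinearMap.trace ℝ (TangentSpace (𝓡 d) x) (recursionOperator ω₁ ω₂ x ^ k)

/-- The point `p` is regular: near `p` there are smooth functions `ev 1, …, ev n` whose values at
each point are `n` distinct (real) eigenvalues of `N`, with linearly independent differentials at
`p`. It is meant for `d = 2 * n`, when `n` is the maximal number of distinct eigenvalues. -/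
def IsRegularPoint (n : ℕ) (ω₁ ω₂ : SymplecticForm d M) (p : M) : Prop :=
  ∃ (U : Set M) (ev : Fin n → M → ℝ), IsOpen U ∧ p ∈ U ∧
    (∀ i, ContMDiffOn (𝓡 d) 𝓘(ℝ, ℝ) ∞ (ev i) U) ∧
    (∀ x ∈ U, ∀ i, (recursionOperator ω₁ ω₂ x).HasEigenvalue (ev i x)) ∧
    (∀ x ∈ U, Function.Injective fun i ↦ ev i x) ∧
    LinearIndependent ℝ (fun i ↦ (diff (ev i) p : TangentSpace (𝓡 d) p →L[ℝ] ℝ))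

/-- The distribution defined by the functions `I_1, …, I_n`: the intersection of the kernels of
their differentials (the tangent spaces to the common level sets). -/
def traceDistribution (n : ℕ) (ω₁ ω₂ : SymplecticForm d M) (x : M) :
    Submodule ℝ (TangentSpace (𝓡 d) x) :=
  ⨅ k : Fin n, (diff (traceFun ω₁ ω₂ (k + 1)) x : TangentSpace (𝓡 d) x →L[ℝ] ℝ).ker

/-- `X` is a section of the distribution `L`: a smooth vector field tangent to `L`. -/
def IsSectionOf (L : Π x : M, Submodule ℝ (TangentSpace (𝓡 d) x))
    (X : Π x : M, TangentSpace (𝓡 d) x) : Prop :=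
  SmoothField X ∧ ∀ x, X x ∈ L x

/-- `L` is Lagrangian: at each point it is its own `Ω`-orthogonal. -/
def IsLagrangian (Ω : SymplecticForm d M) (L : Π x : M, Submodule ℝ (TangentSpace (𝓡 d) x)) :
    Prop :=
  ∀ (x : M) (v : TangentSpace (𝓡 d) x), v ∈ L x ↔ ∀ w ∈ L x, Ω.flat x v w = 0

/-- `L` is involutive. -/
def IsInvolutive (L : Π x : M, Submodule ℝ (TangentSpace (𝓡 d) x)) : Prop :=
  ∀ X Y : Π x : M, TangentSpace (𝓡 d) x, IsSectionOf L X → IsSectionOf L Y →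
    ∀ x, VectorField.mlieBracket (𝓡 d) X Y x ∈ L x

/-- The Bott connection `∇_X Y = Ω♯ (L_X (Ω♭ Y))`. -/
def bottConnection (Ω : SymplecticForm d M) (X Y : Π x : M, TangentSpace (𝓡 d) x) (x : M) :
    TangentSpace (𝓡 d) x :=
  Ω.sharp x (lieDeriv X (fun y ↦ Ω.flat y (Y y)) x)

/-- The Bott connections of `ω₁` and `ω₂` in `L`, as maps on pairs of sections of `L`, coincide. -/
def BottConnectionsCoincide (ω₁ ω₂ : SymplecticForm d M)
    (L : Π x : M, Submodule ℝ (TangentSpace (𝓡 d) x)) : Prop :=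
  ∀ X Y : Π x : M, TangentSpace (𝓡 d) x, IsSectionOf L X → IsSectionOf L Y →
    bottConnection ω₁ X Y = bottConnection ω₂ X Y

end Basics

section Fibrations

variable {n : ℕ} {M : Type u} [TopologicalSpace M]
  [ChartedSpace (EuclideanSpace ℝ (Fin (2 * n))) M] [IsManifold (𝓡 (2 * n)) ∞ M]
  {B : Type v} [TopologicalSpace B] [ChartedSpace (EuclideanSpace ℝ (Fin n)) B]
  [IsManifold (𝓡 n) ∞ B]

/-- `pr : M → B` is a smooth fibration (a smooth, locally trivial fiber bundle) with `n`-dimensional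
base and fibers, all of whose fibers are compact and connected (and nonempty). -/
structure IsCompactConnectedFibration (pr : M → B) : Prop where
  smooth : ContMDiff (𝓡 (2 * n)) (𝓡 n) ∞ pr
  locally_trivial : ∀ b : B, ∃ (F : Type u) (_ : TopologicalSpace F)
    (_ : ChartedSpace (EuclideanSpace ℝ (Fin n)) F) (_ : IsManifold (𝓡 n) ∞ F)
    (e : Trivialization F pr), b ∈ e.baseSet ∧
      ContMDiffOn (𝓡 (2 * n)) ((𝓡 n).prod (𝓡 n)) ∞ e.toOpenPartialHomeomorph e.source ∧
      ContMDiffOn ((𝓡 n).prod (𝓡 n)) (𝓡 (2 * n)) ∞ e.toOpenPartialHomeomorph.symm e.target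
  compact_fibers : ∀ b : B, IsCompact (pr ⁻¹' {b})
  connected_fibers : ∀ b : B, IsConnected (pr ⁻¹' {b})

/-- The tangent spaces to the fibers of `pr`. -/
def verticalDistribution (pr : M → B) (x : M) : Submodule ℝ (TangentSpace (𝓡 (2 * n)) x) :=
  (mfderiv (𝓡 (2 * n)) (𝓡 n) pr x).ker

/-- `ω₁` and `ω₂` are `pr`-compatible: `pr` is a bi-Lagrangian fibration with compact connected fibers,
and the Bott connections of `ω₁` and `ω₂` along its fibers coincide. -/
structure IsPiCompatible (ω₁ ω₂ : SymplecticForm (2 * n) M) (pr : M → B) : Prop where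
  fibration : IsCompactConnectedFibration (n := n) pr
  lagrangian₁ : IsLagrangian ω₁ (verticalDistribution (n := n) pr)
  lagrangian₂ : IsLagrangian ω₂ (verticalDistribution (n := n) pr)
  biaffine : BottConnectionsCoincide ω₁ ω₂ (verticalDistribution (n := n) pr)

/-- Bi-affine compatibility: the two forms are `pr`-compatible for some `pr` (over some base
manifold). -/
def BiAffinelyCompatible (ω₁ ω₂ : SymplecticForm (2 * n) M) : Prop :=
  ∃ (B : Type v) (_ : TopologicalSpace B) (_ : ChartedSpace (EuclideanSpace ℝ (Fin n)) B)
    (_ : IsManifold (𝓡 n) ∞ B) (_ : T2Space B) (_ : SecondCountableTopology B) (pr : M → B),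
    IsPiCompatible ω₁ ω₂ pr

end Fibrations

end BiHam

end

/-! The operator `N` is self-adjoint for both forms, so for each eigenvalue `μ` the form `σ((N -
μ)v, w)` is alternating and its radical is the eigenspace. A parity argument makes every eigenspace
at least two-dimensional. With `n` distinct eigenvalues in dimension `2n`, each eigenspace is
exactly a plane, the planes span, and `Tr N^k = 2 ∑ λ_i^k`.

The geometric core is `MagriCompatible.ham_eigenvalue`: each `dλ_i` satisfies `ω₂♯ dλ_i = λ_i ω₁♯
dλ_i`. Fix `p` and put `c = λ_i(p)`. Compatibility gives the Jacobi identity for `P = ω₂♯ - c ω₁♯`,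
so if `dg` and `dh` lie in `ker P` at `p`, then so does the differential of `{g, h}_P`
(`MagriCompatible.sharp_diff_bracket`). Choosing `g, h` with Hamiltonian vectors in the
`λ_i`-eigenplane and nonzero `ω₁`-pairing, one finds that this differential is a nonzero multiple of
`dλ_i`.

Consequently `dI_{k+1} = 2 ∑ λ_i^k dλ_i`. Vandermonde gives independence of the `dI_k` and
identifies `L` with the common kernel of the `dλ_i`. Eigencovectors with distinct eigenvalues are in
involution for both Poisson tensors, so a dimension count makes `L` Lagrangian; it is involutive as
a common kernel of differentials.

For the Bott connections, set `α_i = L_X(ω_i♭ Y)`. The claim amounts to `α₁ = α₂ ∘ N`, and the two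
sides differ on `Z` by `ω₂(Y, [X, NZ] - N[X, Z])`. The recursion `dI_k ∘ N = dI_{k+1}` shows that
all `dI_k` kill `[X, NZ] - N[X, Z]`; it therefore lies in `L`, and the pairing with `Y` vanishes
because `L` is Lagrangian. The statement about fibrations is then immediate, as the vertical
distribution is `L`. -/

set_option linter.unusedSectionVars false

/-! ### Smoothness through an invertible bundle map -/

section
open ContinuousLinearMap
/-- A section of a vector bundle whose image under a smooth invertible bundle map is smooth is
itself smooth. -/
theorem contMDiffAt_of_clm_bundle_apply {𝕜 : Type*} [NontriviallyNormedField 𝕜]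
    {EB : Type*} [NormedAddCommGroup EB] [NormedSpace 𝕜 EB] {HB : Type*} [TopologicalSpace HB]
    {IB : ModelWithCorners 𝕜 EB HB} {B : Type*} [TopologicalSpace B] [ChartedSpace HB B]
    {F₁ : Type*} [NormedAddCommGroup F₁] [NormedSpace 𝕜 F₁] [CompleteSpace F₁]
    {E₁ : B → Type*} [∀ x, AddCommGroup (E₁ x)] [∀ x, Module 𝕜 (E₁ x)]
    [TopologicalSpace (TotalSpace F₁ E₁)] [∀ x, TopologicalSpace (E₁ x)]
    [FiberBundle F₁ E₁] [VectorBundle 𝕜 F₁ E₁]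
    {F₂ : Type*} [NormedAddCommGroup F₂] [NormedSpace 𝕜 F₂]
    {E₂ : B → Type*} [∀ x, AddCommGroup (E₂ x)] [∀ x, Module 𝕜 (E₂ x)]
    [TopologicalSpace (TotalSpace F₂ E₂)] [∀ x, TopologicalSpace (E₂ x)]
    [∀ x, IsTopologicalAddGroup (E₂ x)] [∀ x, ContinuousSMul 𝕜 (E₂ x)]
    [FiberBundle F₂ E₂] [VectorBundle 𝕜 F₂ E₂] {n : WithTop ℕ∞}
    {φ : Π x, E₁ x →L[𝕜] E₂ x} {v : Π x, E₁ x} {x₀ : B}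
    (hφ : ContMDiffAt IB (IB.prod 𝓘(𝕜, F₁ →L[𝕜] F₂)) n
      (fun x ↦ TotalSpace.mk' (F₁ →L[𝕜] F₂) (E := fun x ↦ E₁ x →L[𝕜] E₂ x) x (φ x)) x₀)
    (hinv : ∀ x, (φ x).IsInvertible)
    (hv : ContMDiffAt IB (IB.prod 𝓘(𝕜, F₂)) n (fun x ↦ TotalSpace.mk' F₂ x (φ x (v x))) x₀) :
    ContMDiffAt IB (IB.prod 𝓘(𝕜, F₁)) n (fun x ↦ TotalSpace.mk' F₁ x (v x)) x₀ := by
  rw [contMDiffAt_hom_bundle] at hφ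
  rw [contMDiffAt_section] at hv ⊢
  have h₁ := FiberBundle.mem_baseSet_trivializationAt F₁ E₁ x₀
  have h₂ := FiberBundle.mem_baseSet_trivializationAt F₂ E₂ x₀
  have key : ∀ x ∈ (trivializationAt F₁ E₁ x₀).baseSet ∩ (trivializationAt F₂ E₂ x₀).baseSet,
      ∃ A : F₁ ≃L[𝕜] F₂, (A : F₁ →L[𝕜] F₂) = inCoordinates F₁ E₁ F₂ E₂ x₀ x x₀ x (φ x) ∧
        A (trivializationAt F₁ E₁ x₀ ⟨x, v x⟩).2 = (trivializationAt F₂ E₂ x₀ ⟨x, φ x (v x)⟩).2 := by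
    rintro x ⟨hx₁, hx₂⟩
    obtain ⟨e, he⟩ := hinv x
    refine ⟨(((trivializationAt F₁ E₁ x₀).continuousLinearEquivAt 𝕜 x hx₁).symm.trans e).trans
      ((trivializationAt F₂ E₂ x₀).continuousLinearEquivAt 𝕜 x hx₂), ?_, ?_⟩
    · rw [inCoordinates_eq hx₁ hx₂, ← he]
      rfl
    · have hh : (trivializationAt F₁ E₁ x₀ ⟨x, v x⟩).2 =
        (trivializationAt F₁ E₁ x₀).continuousLinearEquivAt 𝕜 x hx₁ (v x) := rfl
      rw [hh, ← he, ContinuousLinearEquiv.trans_apply, ContinuousLinearEquiv.trans_apply,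
        ContinuousLinearEquiv.symm_apply_apply]
      rfl
  obtain ⟨A, hA, -⟩ := key x₀ ⟨h₁, h₂⟩
  -- In local trivializations, the section is the inverse operator applied to its image, and
  -- inversion is smooth at invertible operators.
  have hI : ContMDiffAt IB 𝓘(𝕜, F₂ →L[𝕜] F₁) n
      (fun x ↦ (inCoordinates F₁ E₁ F₂ E₂ x₀ x x₀ x (φ x)).inverse) x₀ := by
    refine ContMDiffAt.comp x₀ (g := ContinuousLinearMap.inverse) ?_ hφ.2
    refine ContDiffAt.contMDiffAt ?_
    have := contDiffAt_map_inverse (n := n) A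
    rw [hA] at this
    exact this
  refine (hI.clm_apply hv).congr_of_eventuallyEq ?_
  filter_upwards [(trivializationAt F₁ E₁ x₀).open_baseSet.mem_nhds h₁,
    (trivializationAt F₂ E₂ x₀).open_baseSet.mem_nhds h₂] with x hx₁ hx₂
  obtain ⟨A', hA', hA''⟩ := key x ⟨hx₁, hx₂⟩
  rw [← hA', ContinuousLinearMap.inverse_equiv, ← hA'']
  exact (A'.symm_apply_apply _).symm
end

namespace BiHam

/-! ### Calculus of smooth functions, fields and one-forms -/

section Calculus

variable {d : ℕ} {M : Type u} [TopologicalSpace M] [ChartedSpace (EuclideanSpace ℝ (Fin d)) M]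
  [IsManifold (𝓡 d) ∞ M]

theorem SmoothFun.mdifferentiableAt {f : M → ℝ} (hf : SmoothFun (d := d) f) (x : M) :
    MDifferentiableAt (𝓡 d) 𝓘(ℝ, ℝ) f x :=
  (hf x).mdifferentiableAt (by simp)

theorem SmoothField.mdifferentiableAt {X : Π x : M, TangentSpace (𝓡 d) x} (hX : SmoothField X)
    (x : M) : MDifferentiableAt (𝓡 d) ((𝓡 d).prod 𝓘(ℝ, EuclideanSpace ℝ (Fin d)))
      (fun x ↦ TotalSpace.mk' (EuclideanSpace ℝ (Fin d)) x (X x)) x :=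
  (hX x).mdifferentiableAt (by simp)

theorem SmoothFun.add {f g : M → ℝ} (hf : SmoothFun (d := d) f) (hg : SmoothFun (d := d) g) :
    SmoothFun (d := d) (fun x ↦ f x + g x) :=
  ContMDiff.add hf hg

theorem SmoothFun.sub {f g : M → ℝ} (hf : SmoothFun (d := d) f) (hg : SmoothFun (d := d) g) :
    SmoothFun (d := d) (fun x ↦ f x - g x) :=
  ContMDiff.sub hf hg

theorem SmoothFun.mul {f g : M → ℝ} (hf : SmoothFun (d := d) f) (hg : SmoothFun (d := d) g) :
    SmoothFun (d := d) (fun x ↦ f x * g x) :=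
  ContMDiff.mul hf hg

theorem SmoothFun.const (c : ℝ) : SmoothFun (d := d) (fun _ : M ↦ c) :=
  contMDiff_const

theorem SmoothField.sub {X Y : Π x : M, TangentSpace (𝓡 d) x} (hX : SmoothField X)
    (hY : SmoothField Y) : SmoothField (fun x ↦ X x - Y x) :=
  ContMDiff.sub_section hX hY

theorem SmoothField.smul {X : Π x : M, TangentSpace (𝓡 d) x} (hX : SmoothField X)
    {f : M → ℝ} (hf : SmoothFun (d := d) f) : SmoothField (fun x ↦ f x • X x) :=
  ContMDiff.smul_section hf hX

instance : IsManifold (𝓡 d) (minSmoothness ℝ 3) M :=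
  IsManifold.of_le (n := ∞) (by simpa using WithTop.coe_le_coe.2 (le_top (a := (3 : ℕ∞))))

theorem SmoothField.mlieBracket {X Y : Π x : M, TangentSpace (𝓡 d) x} (hX : SmoothField X)
    (hY : SmoothField Y) : SmoothField (VectorField.mlieBracket (𝓡 d) X Y) :=
  haveI : IsManifold (𝓡 d) (((⊤ : ℕ∞) : WithTop ℕ∞) + 1) M := inferInstanceAs (IsManifold (𝓡 d) ∞ M)
  fun x ↦ ContMDiffAt.mlieBracket_vectorField (n := ⊤) (m := ⊤) (hX x) (hY x) (by simp)

theorem smoothOneForm_diff {f : M → ℝ} (hf : SmoothFun (d := d) f) :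
    SmoothOneForm (diff (d := d) f) := by
  intro x₀
  rw [contMDiffAt_hom_bundle]
  refine ⟨contMDiffAt_id, ?_⟩
  have h := (hf x₀).mfderiv_const (m := ∞) (by simp)
  refine h.congr_of_eventuallyEq (Eventually.of_forall fun x ↦ ?_)
  ext v
  simp [inTangentCoordinates, diff, mvfderiv,
    ContinuousLinearMap.inCoordinates]
  rfl

theorem SmoothOneForm.apply {α : Π x : M, TangentSpace (𝓡 d) x →L[ℝ] ℝ} (hα : SmoothOneForm α)
    {X : Π x : M, TangentSpace (𝓡 d) x} (hX : SmoothField X) :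
    SmoothFun (d := d) (fun x ↦ α x (X x)) := by
  intro x
  have h := ContMDiffAt.clm_bundle_apply (F₁ := EuclideanSpace ℝ (Fin d)) (F₂ := ℝ)
      (E₁ := fun x : M ↦ TangentSpace (𝓡 d) x) (E₂ := Bundle.Trivial M ℝ) (hα x) (hX x)
  exact (contMDiffAt_section (F := ℝ) (E := Bundle.Trivial M ℝ) _).1 h

theorem SmoothField.dirDeriv {X : Π x : M, TangentSpace (𝓡 d) x} (hX : SmoothField X)
    {f : M → ℝ} (hf : SmoothFun (d := d) f) : SmoothFun (d := d) (dirDeriv X f) :=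
  (smoothOneForm_diff hf).apply hX

theorem SymplecticForm.smoothOneForm_flat (Ω : SymplecticForm d M)
    {X : Π x : M, TangentSpace (𝓡 d) x} (hX : SmoothField X) :
    SmoothOneForm (fun x ↦ Ω.flat x (X x)) := by
  intro x
  exact ContMDiffAt.clm_bundle_apply (F₁ := EuclideanSpace ℝ (Fin d))
      (F₂ := EuclideanSpace ℝ (Fin d) →L[ℝ] ℝ)
      (E₁ := fun x : M ↦ TangentSpace (𝓡 d) x)
      (E₂ := fun x : M ↦ TangentSpace (𝓡 d) x →L[ℝ] ℝ) (Ω.smooth x) (hX x)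

theorem SymplecticForm.sharp_flat (Ω : SymplecticForm d M) (x : M) (v : TangentSpace (𝓡 d) x) :
    Ω.sharp x (Ω.flat x v) = v := by
  obtain ⟨e, h₁, h₂⟩ := Ω.exists_equiv x
  rw [← h₁, ← h₂]
  exact e.symm_apply_apply v

theorem SymplecticForm.flat_sharp (Ω : SymplecticForm d M) (x : M)
    (α : TangentSpace (𝓡 d) x →L[ℝ] ℝ) : Ω.flat x (Ω.sharp x α) = α := by
  obtain ⟨e, h₁, h₂⟩ := Ω.exists_equiv x
  rw [← h₁, ← h₂]
  exact e.apply_symm_apply α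

theorem exists_smoothField_eq [T2Space M] {p : M} (v : TangentSpace (𝓡 d) p) :
    ∃ X : Π x : M, TangentSpace (𝓡 d) x, SmoothField X ∧ X p = v := by
  obtain ⟨s, hs, hX⟩ := FiberBundle.exists_contMDiffOn_extend (k := ∞) (𝓡 d)
    (EuclideanSpace ℝ (Fin d)) v
  obtain ⟨u, hus, hu, hpu⟩ := mem_nhds_iff.1 hs
  obtain ⟨φ, -, hφ⟩ :=
    (SmoothBumpFunction.nhds_basis_tsupport (I := 𝓡 d) p).mem_iff.1 (hu.mem_nhds hpu)
  exact ⟨_, φ.contMDiff.contMDiffOn.smul_section_of_tsupport hu hφ (hX.mono hus), by simp⟩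

theorem exists_smoothFun_eventuallyEq [T2Space M] {f : M → ℝ} {U : Set M} (hU : IsOpen U) {p : M}
    (hp : p ∈ U) (hf : ContMDiffOn (𝓡 d) 𝓘(ℝ, ℝ) ∞ f U) :
    ∃ g : M → ℝ, SmoothFun (d := d) g ∧ g =ᶠ[𝓝 p] f := by
  obtain ⟨φ, -, hφ⟩ :=
    (SmoothBumpFunction.nhds_basis_tsupport (I := 𝓡 d) p).mem_iff.1 (hU.mem_nhds hp)
  refine ⟨fun x ↦ φ x • f x, contMDiff_of_tsupport fun x hx ↦ ?_, ?_⟩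
  · exact φ.contMDiffAt.smul
      (hf.contMDiffAt (hU.mem_nhds (hφ (tsupport_smul_subset_left _ _ hx))))
  · filter_upwards [φ.eventuallyEq_one] with x hx
    simp [hx]

theorem exists_smoothFun_diff_eq [T2Space M] (p : M) (α : TangentSpace (𝓡 d) p →L[ℝ] ℝ) :
    ∃ f : M → ℝ, SmoothFun (d := d) f ∧ diff f p = α := by
  obtain ⟨e, he⟩ := isInvertible_mfderiv_extChartAt (I := 𝓡 d) (mem_extChartAt_source (I := 𝓡 d) p)
  -- The covector `α` read in the chart at `p`; the function sought is `ℓ` composed with the chart,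
  -- cut off away from `p`.
  let ℓ : EuclideanSpace ℝ (Fin d) →L[ℝ] ℝ :=
    α ∘L (e.symm : TangentSpace 𝓘(ℝ, EuclideanSpace ℝ (Fin d)) (extChartAt (𝓡 d) p p) →L[ℝ]
      TangentSpace (𝓡 d) p)
  obtain ⟨f, hf, hfe⟩ := exists_smoothFun_eventuallyEq (d := d) (p := p)
    (f := fun x ↦ ℓ (extChartAt (𝓡 d) p x)) (U := (chartAt (EuclideanSpace ℝ (Fin d)) p).source)
    (chartAt _ p).open_source (mem_chart_source _ p)
    (ℓ.contMDiff.comp_contMDiffOn contMDiffOn_extChartAt)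
  refine ⟨f, hf, ?_⟩
  have h₁ : mfderiv (𝓡 d) 𝓘(ℝ, ℝ) f p =
      (mfderiv 𝓘(ℝ, EuclideanSpace ℝ (Fin d)) 𝓘(ℝ, ℝ) ℓ (extChartAt (𝓡 d) p p)) ∘L
      mfderiv (𝓡 d) 𝓘(ℝ, EuclideanSpace ℝ (Fin d)) (extChartAt (𝓡 d) p) p := by
    rw [hfe.mfderiv_eq]
    exact mfderiv_comp p ℓ.mdifferentiableAt (mdifferentiableAt_extChartAt (mem_chart_source _ p))
  ext v
  have h₂ : diff f p v =
      ℓ (mfderiv (𝓡 d) 𝓘(ℝ, EuclideanSpace ℝ (Fin d)) (extChartAt (𝓡 d) p) p v) := by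
    rw [ContinuousLinearMap.mfderiv_eq] at h₁
    exact congrArg (fun T : TangentSpace (𝓡 d) p →L[ℝ] ℝ ↦ T v) h₁
  rw [h₂, ← he]
  exact congrArg α (e.symm_apply_apply v)

/-- The commutator formula `[X, Y] f = X (Y f) - Y (X f)`. -/
theorem diff_mlieBracket [T2Space M] {X Y : Π x : M, TangentSpace (𝓡 d) x} (hX : SmoothField X)
    (hY : SmoothField Y) {f : M → ℝ} (hf : SmoothFun (d := d) f) (x : M) :
    diff f x (VectorField.mlieBracket (𝓡 d) X Y x) =
      dirDeriv X (dirDeriv Y f) x - dirDeriv Y (dirDeriv X f) x := by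
  -- The argument compares coefficients of a nonvanishing test vector `W x`, so the zero tangent
  -- space is set apart.
  by_cases htriv : ∀ w : TangentSpace (𝓡 d) x, w = 0
  · simp only [dirDeriv]
    rw [htriv (VectorField.mlieBracket (𝓡 d) X Y x), htriv (X x), htriv (Y x)]
    simp
  push Not at htriv
  obtain ⟨w, hw⟩ := htriv
  obtain ⟨W, hW, rfl⟩ := exists_smoothField_eq w
  have hXW := hX.mlieBracket hW
  have hYW := hY.mlieBracket hW
  have expand : ∀ {U : Π x : M, TangentSpace (𝓡 d) x}, SmoothField U → ∀ {V},
      SmoothField V → ∀ {g : M → ℝ}, SmoothFun (d := d) g →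
      VectorField.mlieBracket (𝓡 d) U (g • V) =
        (dirDeriv U g) • V + g • VectorField.mlieBracket (𝓡 d) U V := by
    intro U hU V hV g hg
    funext y
    exact VectorField.mlieBracket_smul_right (hg.mdifferentiableAt y) (hV.mdifferentiableAt y)
  have add : ∀ {U V V' : Π x : M, TangentSpace (𝓡 d) x}, SmoothField V → SmoothField V' →
      VectorField.mlieBracket (𝓡 d) U (V + V') x =
        VectorField.mlieBracket (𝓡 d) U V x + VectorField.mlieBracket (𝓡 d) U V' x :=
    fun hV hV' ↦ VectorField.mlieBracket_add_right (hV.mdifferentiableAt x)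
      (hV'.mdifferentiableAt x)
  have smooth2 : ∀ {V : Π x : M, TangentSpace (𝓡 d) x}, SmoothField V →
      ContMDiffAt (𝓡 d) ((𝓡 d).prod 𝓘(ℝ, EuclideanSpace ℝ (Fin d))) (minSmoothness ℝ 2)
      (fun x ↦ TotalSpace.mk' (EuclideanSpace ℝ (Fin d)) x (V x)) x :=
    fun hV ↦ (hV x).of_le (by simpa using WithTop.coe_le_coe.2 (le_top (a := (2 : ℕ∞))))
  -- The Jacobi identity is used for `W` and for `f • W`. After expansion of the second and
  -- subtraction of `f` times the first, only the desired difference times `W x` survives.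
  have jac := VectorField.leibniz_identity_mlieBracket_apply (smooth2 hX) (smooth2 hY) (smooth2 hW)
  have jacf := VectorField.leibniz_identity_mlieBracket_apply (smooth2 hX) (smooth2 hY)
    (smooth2 (hW.smul hf))
  change VectorField.mlieBracket (𝓡 d) X (VectorField.mlieBracket (𝓡 d) Y (f • W)) x =
    VectorField.mlieBracket (𝓡 d) (VectorField.mlieBracket (𝓡 d) X Y) (f • W) x +
    VectorField.mlieBracket (𝓡 d) Y (VectorField.mlieBracket (𝓡 d) X (f • W)) x at jacf
  rw [expand hY hW hf, expand hX hW hf,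
    add (V := dirDeriv Y f • W) (V' := f • VectorField.mlieBracket (𝓡 d) Y W)
      (hW.smul (hY.dirDeriv hf)) (hYW.smul hf),
    add (V := dirDeriv X f • W) (V' := f • VectorField.mlieBracket (𝓡 d) X W)
      (hW.smul (hX.dirDeriv hf)) (hXW.smul hf), expand hX hW (hY.dirDeriv hf),
    expand hY hW (hX.dirDeriv hf), expand hX hYW hf, expand hY hXW hf,
    expand (hX.mlieBracket hY) hW hf] at jacf
  simp only [Pi.add_apply, Pi.smul_apply', jac] at jacf
  have h : (diff f x (VectorField.mlieBracket (𝓡 d) X Y x) -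
      (dirDeriv X (dirDeriv Y f) x - dirDeriv Y (dirDeriv X f) x)) • W x = 0 := by
    rw [← sub_eq_zero] at jacf
    rw [← neg_eq_zero, ← jacf]
    have e : dirDeriv (VectorField.mlieBracket (𝓡 d) X Y) f x =
      diff f x (VectorField.mlieBracket (𝓡 d) X Y x) := rfl
    rw [e]
    module
  rcases smul_eq_zero.1 h with h | h
  · linarith
  · exact absurd h hw

theorem SymplecticForm.smoothField_sharp (Ω : SymplecticForm d M)
    {α : Π x : M, TangentSpace (𝓡 d) x →L[ℝ] ℝ} (hα : SmoothOneForm α) :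
    SmoothField (fun x ↦ Ω.sharp x (α x)) := by
  intro x
  refine contMDiffAt_of_clm_bundle_apply (F₁ := EuclideanSpace ℝ (Fin d))
      (F₂ := EuclideanSpace ℝ (Fin d) →L[ℝ] ℝ) (E₁ := fun x : M ↦ TangentSpace (𝓡 d) x)
      (E₂ := fun x : M ↦ TangentSpace (𝓡 d) x →L[ℝ] ℝ) (Ω.smooth x) (fun y ↦ ?_) ?_
  · obtain ⟨e, h, -⟩ := Ω.exists_equiv y
    exact ⟨e, h⟩
  · simp only [Ω.flat_sharp]
    exact hα x

end Calculus


/-! ### Self-adjoint operators on a symplectic vector space -/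

section LinearAlgebra

variable {V : Type*} [AddCommGroup V] [Module ℝ V] [FiniteDimensional ℝ V]

/-- An alternating form on an odd-dimensional space is degenerate. -/
theorem exists_ne_zero_of_isAlt_of_odd {A : LinearMap.BilinForm ℝ V} (hA : A.IsAlt)
    (hV : Odd (Module.finrank ℝ V)) : ∃ v, v ≠ 0 ∧ ∀ w, A v w = 0 := by
  let b := Module.finBasis ℝ V
  let m : Matrix _ _ ℝ := Matrix.of fun i j ↦ A (b i) (b j)
  have hm : m.transpose = -m := by
    ext i j
    exact (hA.neg_eq (b i) (b j)).symm
  -- A skew-symmetric matrix of odd size satisfies `det m = -det m`.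
  have hdet : m.det = 0 := by
    have h := m.det_transpose
    rw [hm, Matrix.det_neg, Fintype.card_fin, hV.neg_one_pow] at h
    linarith
  obtain ⟨c, hc0, hc⟩ := Matrix.exists_vecMul_eq_zero_iff.2 hdet
  refine ⟨∑ i, c i • b i, fun h ↦ hc0 ?_, fun w ↦ ?_⟩
  · exact funext (Fintype.linearIndependent_iff.1 b.linearIndependent c h)
  · have h : A (∑ i, c i • b i) = 0 := b.ext fun j ↦ by
      have := congrFun hc j
      simpa [Matrix.vecMul, dotProduct, m] using this
    rw [h, LinearMap.zero_apply]

variable {σ : LinearMap.BilinForm ℝ V} {N : Module.End ℝ V}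

/-- If the eigenspace were a line, a complement `W` would have odd dimension, and the alternating
form `σ((N - μ)v, w)` would have a radical vector in `W`. By self-adjointness that vector also pairs
to zero with the eigenspace, so nondegeneracy of `σ` puts it in the eigenspace, against
complementarity. -/
theorem two_le_finrank_eigenspace (halt : σ.IsAlt) (hnd : ∀ v, (∀ w, σ v w = 0) → v = 0)
    (hN : ∀ v w, σ (N v) w = σ v (N w)) (hV : Even (Module.finrank ℝ V)) {μ : ℝ}
    (hμ : N.HasEigenvalue μ) : 2 ≤ Module.finrank ℝ (N.eigenspace μ) := by
  have hpos : 0 < Module.finrank ℝ (N.eigenspace μ) := by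
    rw [Module.finrank_pos_iff, Submodule.nontrivial_iff_ne_bot]
    exact hμ
  by_contra! hlt
  have h1 : Module.finrank ℝ (N.eigenspace μ) = 1 := by omega
  obtain ⟨W, hW⟩ := (N.eigenspace μ).exists_isCompl
  have hsum := Submodule.finrank_add_eq_of_isCompl hW
  have hodd : Odd (Module.finrank ℝ W) := by
    rw [h1] at hsum
    rw [← hsum] at hV
    rw [add_comm, Nat.even_add_one] at hV
    exact Nat.not_even_iff_odd.1 hV
  let A : LinearMap.BilinForm ℝ W := (σ.comp (N - algebraMap ℝ _ μ) LinearMap.id).restrict W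
  have hAapp : ∀ v w : W, A v w = σ (N v - μ • (v : V)) w := fun v w ↦ by
    have h : A v w = σ ((N - algebraMap ℝ _ μ) (v : V)) w := rfl
    rw [h, LinearMap.sub_apply, Module.algebraMap_end_apply]
  have hA : A.IsAlt := fun v ↦ by
    have h := hN v v
    rw [hAapp]
    have h' := halt.neg_eq (N v) v
    rw [map_sub, map_smul, LinearMap.sub_apply, LinearMap.smul_apply, halt.self_eq_zero, smul_zero]
    linarith
  obtain ⟨v, hv0, hv⟩ := exists_ne_zero_of_isAlt_of_odd hA hodd
  apply hv0
  have hmem : (v : V) ∈ N.eigenspace μ := by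
    rw [Module.End.mem_eigenspace_iff, ← sub_eq_zero]
    refine hnd _ fun w ↦ ?_
    obtain ⟨e, he, w', hw', rfl⟩ := Submodule.mem_sup.1
      (hW.sup_eq_top ▸ Submodule.mem_top : w ∈ N.eigenspace μ ⊔ W)
    have h₁ := hv ⟨w', hw'⟩
    rw [hAapp] at h₁
    rw [map_add, h₁, map_sub, LinearMap.sub_apply, hN, Module.End.mem_eigenspace_iff.1 he]
    simp
  have := Submodule.disjoint_def.1 hW.disjoint _ hmem v.2
  exact_mod_cast this

variable {n : ℕ} {ev : Fin n → ℝ}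

/-- The `n` independent eigenspaces have dimension at least 2 each inside a space of dimension `2n`,
so every inequality is an equality. -/
theorem finrank_eigenspace_and_iSup (halt : σ.IsAlt) (hnd : ∀ v, (∀ w, σ v w = 0) → v = 0)
    (hN : ∀ v w, σ (N v) w = σ v (N w)) (hV : Module.finrank ℝ V = 2 * n)
    (hev : ∀ i, N.HasEigenvalue (ev i)) (hinj : Function.Injective ev) :
    (∀ i, Module.finrank ℝ (N.eigenspace (ev i)) = 2) ∧ ⨆ i, N.eigenspace (ev i) = ⊤ := by
  have hge : ∀ i, 2 ≤ Module.finrank ℝ (N.eigenspace (ev i)) := fun i ↦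
    two_le_finrank_eigenspace halt hnd hN ⟨n, by omega⟩ (hev i)
  have hind : iSupIndep fun i ↦ N.eigenspace (ev i) := N.eigenspaces_iSupIndep.comp hinj
  have hsum : Module.finrank ℝ (⨆ i, N.eigenspace (ev i) : Submodule ℝ V) =
      ∑ i, Module.finrank ℝ (N.eigenspace (ev i)) := by
    have h := LinearMap.finrank_range_of_inj hind.dfinsupp_lsum_injective
    rw [← Submodule.iSup_eq_range_dfinsupp_lsum] at h
    exact h.trans (Module.finrank_directSum (R := ℝ) fun i ↦ N.eigenspace (ev i))
  have hle := Submodule.finrank_le (⨆ i, N.eigenspace (ev i))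
  have hle' : ∑ i : Fin n, 2 ≤ ∑ i, Module.finrank ℝ (N.eigenspace (ev i)) :=
    Finset.sum_le_sum fun i _ ↦ hge i
  have heq : ∑ i : Fin n, 2 = ∑ i, Module.finrank ℝ (N.eigenspace (ev i)) := by
    refine le_antisymm hle' ?_
    rw [← hsum]
    simp
    omega
  refine ⟨fun i ↦ ?_, Submodule.eq_top_of_finrank_eq ?_⟩
  · exact ((Finset.sum_eq_sum_iff_of_le fun i _ ↦ hge i).1 heq i (Finset.mem_univ i)).symm
  · rw [hsum, ← heq]
    simp
    omega

theorem trace_pow_eq (halt : σ.IsAlt) (hnd : ∀ v, (∀ w, σ v w = 0) → v = 0)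
    (hN : ∀ v w, σ (N v) w = σ v (N w)) (hV : Module.finrank ℝ V = 2 * n)
    (hev : ∀ i, N.HasEigenvalue (ev i)) (hinj : Function.Injective ev) (k : ℕ) :
    LinearMap.trace ℝ V (N ^ k) = 2 * ∑ i, ev i ^ k := by
  obtain ⟨hrank, htop⟩ := finrank_eigenspace_and_iSup halt hnd hN hV hev hinj
  have hind : iSupIndep fun i ↦ N.eigenspace (ev i) := N.eigenspaces_iSupIndep.comp hinj
  have hint : DirectSum.IsInternal fun i ↦ N.eigenspace (ev i) :=
    DirectSum.isInternal_submodule_of_iSupIndep_of_iSup_eq_top hind htop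
  have hpow : ∀ i, ∀ v ∈ N.eigenspace (ev i), (N ^ k) v = ev i ^ k • v := by
    intro i v hv
    induction k with
    | zero => simp
    | succ k ih =>
      rw [pow_succ', Module.End.mul_apply, ih, map_smul, Module.End.mem_eigenspace_iff.1 hv,
        smul_smul, pow_succ]
  have hmaps : ∀ i, MapsTo (N ^ k) (N.eigenspace (ev i)) (N.eigenspace (ev i)) := by
    intro i v hv
    rw [hpow i v hv]
    exact Submodule.smul_mem _ _ hv
  rw [LinearMap.trace_eq_sum_trace_restrict hint hmaps, Finset.mul_sum]
  refine Finset.sum_congr rfl fun i _ ↦ ?_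
  have : (N ^ k).restrict (hmaps i) = ev i ^ k • LinearMap.id := by
    ext v
    exact hpow i v v.2
  rw [this, map_smul, LinearMap.trace_id, hrank]
  simp [mul_comm]

theorem apply_eq_zero_of_mem_eigenspace (hN : ∀ v w, σ (N v) w = σ v (N w)) {a b : ℝ}
    (hab : a ≠ b) {v w : V} (hv : v ∈ N.eigenspace a) (hw : w ∈ N.eigenspace b) : σ v w = 0 := by
  have h := hN v w
  rw [Module.End.mem_eigenspace_iff.1 hv, Module.End.mem_eigenspace_iff.1 hw, map_smul, map_smul,
    LinearMap.smul_apply, smul_eq_mul, smul_eq_mul, ← sub_eq_zero, ← sub_mul] at h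
  exact (mul_eq_zero.1 h).resolve_left (sub_ne_zero.2 hab)

theorem eq_zero_of_forall_eigenspace (hnd : ∀ v, (∀ w, σ v w = 0) → v = 0)
    (htop : ⨆ i, N.eigenspace (ev i) = ⊤) {v : V}
    (h : ∀ i, ∀ w ∈ N.eigenspace (ev i), σ v w = 0) : v = 0 := by
  refine hnd v fun w ↦ ?_
  have : ⨆ i, N.eigenspace (ev i) ≤ LinearMap.ker (σ v) := iSup_le fun i w hw ↦ h i w hw
  exact this (htop ▸ Submodule.mem_top)

/-- Distinct eigenspaces are `σ`-orthogonal and together span, so `σ` stays nondegenerate on each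
one. -/
theorem exists_mem_eigenspace_apply_ne_zero (hnd : ∀ v, (∀ w, σ v w = 0) → v = 0)
    (hN : ∀ v w, σ (N v) w = σ v (N w)) (hinj : Function.Injective ev)
    (htop : ⨆ i, N.eigenspace (ev i) = ⊤) {i : Fin n} {v : V} (hv : v ∈ N.eigenspace (ev i))
    (hv0 : v ≠ 0) : ∃ w ∈ N.eigenspace (ev i), σ v w ≠ 0 := by
  by_contra! hcon
  refine hv0 (eq_zero_of_forall_eigenspace hnd htop fun j w hw ↦ ?_)
  rcases eq_or_ne i j with rfl | hij
  · exact hcon w hw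
  · exact apply_eq_zero_of_mem_eigenspace hN (hinj.ne hij) hv hw

/-- A vector orthogonal to all eigenspaces but one lies in that eigenspace. -/
theorem mem_eigenspace_of_orthogonal (hnd : ∀ v, (∀ w, σ v w = 0) → v = 0)
    (hN : ∀ v w, σ (N v) w = σ v (N w)) (htop : ⨆ i, N.eigenspace (ev i) = ⊤) {i : Fin n} {v : V}
    (h : ∀ j ≠ i, ∀ w ∈ N.eigenspace (ev j), σ v w = 0) : v ∈ N.eigenspace (ev i) := by
  rw [Module.End.mem_eigenspace_iff, ← sub_eq_zero]
  refine eq_zero_of_forall_eigenspace hnd htop fun j w hw ↦ ?_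
  rw [map_sub, LinearMap.sub_apply, hN, Module.End.mem_eigenspace_iff.1 hw]
  rcases eq_or_ne j i with rfl | hji
  · simp
  · simp [h j hji w hw]

end LinearAlgebra


/-! ### Poisson brackets and the pencil of two compatible forms -/

section Poisson

variable {d : ℕ} {M : Type u} [TopologicalSpace M] [ChartedSpace (EuclideanSpace ℝ (Fin d)) M]
  [IsManifold (𝓡 d) ∞ M]

theorem diff_add {f g : M → ℝ} (hf : SmoothFun (d := d) f) (hg : SmoothFun (d := d) g) (x : M) :
    diff (d := d) (fun y ↦ f y + g y) x = diff f x + diff g x :=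
  mvfderiv_fun_add (hf.mdifferentiableAt x) (hg.mdifferentiableAt x)

theorem diff_mul {f g : M → ℝ} (hf : SmoothFun (d := d) f) (hg : SmoothFun (d := d) g) (x : M) :
    diff (d := d) (fun y ↦ f y * g y) x = f x • diff g x + g x • diff f x :=
  mvfderiv_fun_mul (hf.mdifferentiableAt x) (hg.mdifferentiableAt x)

theorem diff_const (c : ℝ) (x : M) : diff (d := d) (fun _ : M ↦ c) x = 0 :=
  mvfderiv_const c

theorem diff_neg (f : M → ℝ) (x : M) : diff (d := d) (fun y ↦ -f y) x = -diff f x :=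
  mvfderiv_fun_neg

theorem diff_const_mul {f : M → ℝ} (c : ℝ) (hf : SmoothFun (d := d) f) (x : M) :
    diff (d := d) (fun y ↦ c * f y) x = c • diff f x := by
  rw [diff_mul (SmoothFun.const c) hf, diff_const]
  simp

theorem diff_congr {f g : M → ℝ} {x : M} (h : f =ᶠ[𝓝 x] g) :
    diff (d := d) f x = diff g x := by
  ext v
  simp only [diff, mvfderiv, h.mfderiv_eq]
  rfl

/-- The Hamiltonian vector field of a function. -/
noncomputable def SymplecticForm.ham (Ω : SymplecticForm d M) (f : M → ℝ) (x : M) :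
    TangentSpace (𝓡 d) x :=
  Ω.sharp x (diff f x)

variable (Ω : SymplecticForm d M)

theorem SymplecticForm.flat_neg (x : M) (v w : TangentSpace (𝓡 d) x) :
    Ω.flat x v w = -Ω.flat x w v := by
  have h := Ω.alternating x (v + w)
  simp only [map_add, _root_.add_apply, Ω.alternating] at h
  linarith

theorem SymplecticForm.flat_ham (f : M → ℝ) (x : M) (v : TangentSpace (𝓡 d) x) :
    Ω.flat x (Ω.ham f x) v = diff f x v := by
  rw [ham, Ω.flat_sharp]

theorem SymplecticForm.smoothField_ham {f : M → ℝ} (hf : SmoothFun (d := d) f) :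
    SmoothField (Ω.ham f) :=
  Ω.smoothField_sharp (smoothOneForm_diff hf)

theorem SymplecticForm.smoothFun_flat {X Y : Π x : M, TangentSpace (𝓡 d) x} (hX : SmoothField X)
    (hY : SmoothField Y) : SmoothFun (d := d) (fun x ↦ Ω.flat x (X x) (Y x)) :=
  (Ω.smoothOneForm_flat hX).apply hY

theorem SymplecticForm.flat_ham_ham (f g : M → ℝ) :
    (fun x ↦ Ω.flat x (Ω.ham f x) (Ω.ham g x)) = bracket Ω.sharp f g := by
  funext x
  rw [Ω.flat_ham]
  rfl

theorem SymplecticForm.dirDeriv_ham (f g : M → ℝ) :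
    dirDeriv (Ω.ham f) g = bracket Ω.sharp g f := rfl

theorem SymplecticForm.bracket_swap (f g : M → ℝ) :
    bracket Ω.sharp f g = fun x ↦ -bracket Ω.sharp g f x := by
  rw [← Ω.flat_ham_ham, ← Ω.flat_ham_ham]
  exact funext fun x ↦ Ω.flat_neg x _ _

theorem SymplecticForm.smoothFun_bracket {f g : M → ℝ} (hf : SmoothFun (d := d) f)
    (hg : SmoothFun (d := d) g) : SmoothFun (d := d) (bracket Ω.sharp f g) :=
  (Ω.smoothField_ham hg).dirDeriv hf

theorem bracket_neg_right
    (P : Π x : M, (TangentSpace (𝓡 d) x →L[ℝ] ℝ) →L[ℝ] TangentSpace (𝓡 d) x) (f g : M → ℝ)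
    (x : M) : bracket P f (fun y ↦ -g y) x = -bracket P f g x := by
  simp only [bracket]
  rw [diff_neg, map_neg, map_neg]

theorem bracket_add_right
    (P : Π x : M, (TangentSpace (𝓡 d) x →L[ℝ] ℝ) →L[ℝ] TangentSpace (𝓡 d) x) (f : M → ℝ)
    {g h : M → ℝ} (hg : SmoothFun (d := d) g) (hh : SmoothFun (d := d) h) (x : M) :
    bracket P f (fun y ↦ g y + h y) x = bracket P f g x + bracket P f h x := by
  simp only [bracket]
  rw [diff_add hg hh, map_add, map_add]

theorem bracket_const_mul_right
    (P : Π x : M, (TangentSpace (𝓡 d) x →L[ℝ] ℝ) →L[ℝ] TangentSpace (𝓡 d) x) (f : M → ℝ) (c : ℝ)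
    {g : M → ℝ} (hg : SmoothFun (d := d) g) (x : M) :
    bracket P f (fun y ↦ c * g y) x = c * bracket P f g x := by
  simp only [bracket]
  rw [diff_const_mul c hg, map_smul, map_smul, smul_eq_mul]

/-- The cyclic sum `{f, {g, h}} + {g, {h, f}} + {h, {f, g}}` for two brackets. -/
noncomputable def jacobiator
    (P Q : Π x : M, (TangentSpace (𝓡 d) x →L[ℝ] ℝ) →L[ℝ] TangentSpace (𝓡 d) x)
    (f g h : M → ℝ) (x : M) : ℝ :=
  bracket P f (bracket Q g h) x + bracket P g (bracket Q h f) x + bracket P h (bracket Q f g) x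

/-- The Poisson bracket of a symplectic form satisfies the Jacobi identity. -/
theorem SymplecticForm.jacobiator_eq_zero [T2Space M] {f g h : M → ℝ}
    (hf : SmoothFun (d := d) f) (hg : SmoothFun (d := d) g) (hh : SmoothFun (d := d) h) (x : M) :
    jacobiator Ω.sharp Ω.sharp f g h x = 0 := by
  have hX := Ω.smoothField_ham hf
  have hY := Ω.smoothField_ham hg
  have hZ := Ω.smoothField_ham hh
  have hc := Ω.closed _ _ _ hX hY hZ x
  have swap : ∀ a b c : M → ℝ,
      bracket Ω.sharp (bracket Ω.sharp a b) c x = -bracket Ω.sharp c (bracket Ω.sharp a b) x :=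
    fun a b c ↦ congrFun (Ω.bracket_swap _ _) x
  have swap' : ∀ a b c : M → ℝ,
      bracket Ω.sharp c (bracket Ω.sharp a b) x = -bracket Ω.sharp c (bracket Ω.sharp b a) x :=
    fun a b c ↦ by rw [Ω.bracket_swap a b, bracket_neg_right]
  -- On Hamiltonian fields, every term of `dΩ = 0` becomes an iterated bracket, and the sum is a
  -- multiple of the Jacobi sum.
  rw [extDerivTwo, Ω.flat_ham_ham, Ω.flat_ham_ham, Ω.flat_ham_ham, Ω.flat_neg x _ (Ω.ham h x),
    Ω.flat_neg x _ (Ω.ham g x), Ω.flat_neg x _ (Ω.ham f x), Ω.flat_ham, Ω.flat_ham, Ω.flat_ham,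
    diff_mlieBracket hX hY hh, diff_mlieBracket hX hZ hg, diff_mlieBracket hY hZ hf] at hc
  simp only [Ω.dirDeriv_ham, swap] at hc
  rw [swap' f h g, swap' h g f, swap' g f h] at hc
  rw [jacobiator]
  linarith

/-- For Magri-compatible forms, the Schouten bracket of the two Poisson tensors vanishes. -/
theorem MagriCompatible.jacobiator_add_jacobiator [T2Space M] {Ω₁ Ω₂ : SymplecticForm d M}
    (hM : MagriCompatible Ω₁ Ω₂) {f g h : M → ℝ} (hf : SmoothFun (d := d) f)
    (hg : SmoothFun (d := d) g) (hh : SmoothFun (d := d) h) (x : M) :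
    jacobiator Ω₁.sharp Ω₂.sharp f g h x + jacobiator Ω₂.sharp Ω₁.sharp f g h x = 0 := by
  have key : ∀ {a b c : M → ℝ}, SmoothFun (d := d) a → SmoothFun (d := d) b →
      SmoothFun (d := d) c →
      bracket (fun x ↦ Ω₁.sharp x + Ω₂.sharp x) a
        (bracket (fun x ↦ Ω₁.sharp x + Ω₂.sharp x) b c) x =
      bracket Ω₁.sharp a (bracket Ω₁.sharp b c) x + bracket Ω₁.sharp a (bracket Ω₂.sharp b c) x +
      (bracket Ω₂.sharp a (bracket Ω₁.sharp b c) x +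
        bracket Ω₂.sharp a (bracket Ω₂.sharp b c) x) := by
    intro a b c ha hb hc
    have e : ∀ u v : M → ℝ, bracket (fun x ↦ Ω₁.sharp x + Ω₂.sharp x) u v =
        fun y ↦ bracket Ω₁.sharp u v y + bracket Ω₂.sharp u v y := by
      intro u v
      funext y
      simp only [bracket, _root_.add_apply, map_add]
    simp only [e]
    rw [bracket_add_right _ _ (Ω₁.smoothFun_bracket hb hc) (Ω₂.smoothFun_bracket hb hc),
      bracket_add_right _ _ (Ω₁.smoothFun_bracket hb hc) (Ω₂.smoothFun_bracket hb hc)]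
  -- The Jacobi sum of the summed tensor is the two pure sums, both zero, plus the mixed terms.
  have hj := hM.jacobi f g h hf hg hh x
  rw [key hf hg hh, key hg hh hf, key hh hf hg] at hj
  have h₁ := Ω₁.jacobiator_eq_zero hf hg hh x
  have h₂ := Ω₂.jacobiator_eq_zero hf hg hh x
  simp only [jacobiator] at h₁ h₂ ⊢
  linarith

/-- If `g` and `h` are critical for the Poisson tensor `Ω₂♯ - c Ω₁♯` at `x`, so is their bracket. -/
theorem MagriCompatible.sharp_diff_bracket [T2Space M] {Ω₁ Ω₂ : SymplecticForm d M}
    (hM : MagriCompatible Ω₁ Ω₂) {g h : M → ℝ} (hg : SmoothFun (d := d) g)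
    (hh : SmoothFun (d := d) h) {x : M} {c : ℝ} (hgx : Ω₂.ham g x = c • Ω₁.ham g x)
    (hhx : Ω₂.ham h x = c • Ω₁.ham h x) :
    Ω₂.ham (fun y ↦ bracket Ω₂.sharp g h y - c * bracket Ω₁.sharp g h y) x =
      c • Ω₁.ham (fun y ↦ bracket Ω₂.sharp g h y - c * bracket Ω₁.sharp g h y) x := by
  -- At `x`, bracketing `g` or `h` with anything under `Ω₂♯ - c Ω₁♯` gives zero.
  have crit : ∀ {g : M → ℝ}, Ω₂.ham g x = c • Ω₁.ham g x → ∀ u : M → ℝ,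
      bracket Ω₂.sharp g u x = c * bracket Ω₁.sharp g u x := by
    intro g hgx u
    rw [Ω₂.bracket_swap, Ω₁.bracket_swap]
    change -diff u x (Ω₂.ham g x) = c * -diff u x (Ω₁.ham g x)
    rw [hgx, map_smul, smul_eq_mul]
    ring
  set F : M → ℝ := fun y ↦ bracket Ω₂.sharp g h y - c * bracket Ω₁.sharp g h y with hF
  have hFe : F = fun y ↦ bracket Ω₂.sharp g h y + (-c) * bracket Ω₁.sharp g h y := by
    funext y
    simp only [hF]
    ring
  have expand : ∀ (Ω : SymplecticForm d M) (f : M → ℝ), bracket Ω.sharp f F x =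
      bracket Ω.sharp f (bracket Ω₂.sharp g h) x +
        (-c) * bracket Ω.sharp f (bracket Ω₁.sharp g h) x := by
    intro Ω f
    rw [hFe, bracket_add_right _ _ (Ω₂.smoothFun_bracket hg hh)
      ((SmoothFun.const _).mul (Ω₁.smoothFun_bracket hg hh)),
      bracket_const_mul_right _ _ _ (Ω₁.smoothFun_bracket hg hh)]
  have hall : ∀ f : M → ℝ, SmoothFun (d := d) f →
      bracket Ω₂.sharp f F x = c * bracket Ω₁.sharp f F x := by
    intro f hf
    rw [expand, expand]
    have h₁ := Ω₁.jacobiator_eq_zero hf hg hh x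
    have h₂ := Ω₂.jacobiator_eq_zero hf hg hh x
    have h₁₂ := hM.jacobiator_add_jacobiator hf hg hh x
    simp only [jacobiator] at h₁ h₂ h₁₂
    rw [crit hgx, crit hhx] at h₂ h₁₂
    -- This combination is the Jacobi identity of `Ω₂♯ - c Ω₁♯`; by `crit` only its term with `f`
    -- outermost remains.
    linear_combination h₂ + c ^ 2 * h₁ - c * h₁₂
  rw [← sub_eq_zero]
  refine Ω₁.nondegenerate x _ fun w ↦ ?_
  obtain ⟨f, hf, hfw⟩ := exists_smoothFun_diff_eq (d := d) x (Ω₁.flat x w)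
  rw [Ω₁.flat_neg, ← hfw, map_sub, map_smul, smul_eq_mul, neg_eq_zero, sub_eq_zero]
  exact hall f hf

end Poisson


/-! ### The recursion operator and the differentials of its eigenvalues -/

section Recursion

variable {d : ℕ} {M : Type u} [TopologicalSpace M] [ChartedSpace (EuclideanSpace ℝ (Fin d)) M]
  [IsManifold (𝓡 d) ∞ M]

instance (x : M) : FiniteDimensional ℝ (TangentSpace (𝓡 d) x) :=
  inferInstanceAs (FiniteDimensional ℝ (EuclideanSpace ℝ (Fin d)))

theorem finrank_tangentSpace (x : M) : Module.finrank ℝ (TangentSpace (𝓡 d) x) = d :=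
  finrank_euclideanSpace_fin (𝕜 := ℝ) (n := d)

/-- A symplectic form at a point, as a bilinear form. -/
noncomputable def SymplecticForm.bilin (Ω : SymplecticForm d M) (x : M) :
    LinearMap.BilinForm ℝ (TangentSpace (𝓡 d) x) :=
  (ContinuousLinearMap.coeLM ℝ).comp (Ω.flat x).toLinearMap

theorem SymplecticForm.bilin_apply (Ω : SymplecticForm d M) (x : M)
    (v w : TangentSpace (𝓡 d) x) : Ω.bilin x v w = Ω.flat x v w := rfl

variable (Ω₁ Ω₂ : SymplecticForm d M)

theorem flat_recursionOperator_left (x : M) (v w : TangentSpace (𝓡 d) x) :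
    Ω₂.flat x (recursionOperator Ω₁ Ω₂ x v) w = Ω₁.flat x v w := by
  change Ω₂.flat x (Ω₂.sharp x (Ω₁.flat x v)) w = _
  rw [Ω₂.flat_sharp]

theorem flat_recursionOperator_right (x : M) (v w : TangentSpace (𝓡 d) x) :
    Ω₂.flat x v (recursionOperator Ω₁ Ω₂ x w) = Ω₁.flat x v w := by
  rw [Ω₂.flat_neg, flat_recursionOperator_left, Ω₁.flat_neg x v w]

theorem recursionOperator_symm (x : M) (v w : TangentSpace (𝓡 d) x) :
    Ω₁.bilin x (recursionOperator Ω₁ Ω₂ x v) w = Ω₁.bilin x v (recursionOperator Ω₁ Ω₂ x w) := by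
  simp only [SymplecticForm.bilin_apply]
  rw [← flat_recursionOperator_right Ω₁ Ω₂, flat_recursionOperator_left]

theorem recursionOperator_ham (f : M → ℝ) (x : M) :
    recursionOperator Ω₁ Ω₂ x (Ω₁.ham f x) = Ω₂.ham f x := by
  change Ω₂.sharp x (Ω₁.flat x (Ω₁.sharp x _)) = _
  rw [Ω₁.flat_sharp]
  rfl

theorem SmoothField.recursionOperator {X : Π x : M, TangentSpace (𝓡 d) x} (hX : SmoothField X) :
    SmoothField (fun x ↦ recursionOperator Ω₁ Ω₂ x (X x)) :=
  Ω₂.smoothField_sharp (Ω₁.smoothOneForm_flat hX)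

/-- The pairing of two fields vanishing at a point vanishes to second order there. -/
theorem SymplecticForm.diff_flat_eq_zero [T2Space M] (Ω : SymplecticForm d M)
    {X Y : Π x : M, TangentSpace (𝓡 d) x} (hX : SmoothField X) (hY : SmoothField Y) {p : M}
    (hXp : X p = 0) (hYp : Y p = 0) : diff (d := d) (fun x ↦ Ω.flat x (X x) (Y x)) p = 0 := by
  ext v
  obtain ⟨Z, hZ, rfl⟩ := exists_smoothField_eq v
  have hXY : VectorField.mlieBracket (𝓡 d) X Y p = 0 := by
    rw [← VectorField.mlieBracketWithin_univ]
    exact VectorField.mlieBracketWithin_eq_zero_of_eq_zero hXp hYp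
  -- In `dΩ(X, Y, Z) = 0` every term except `Z[Ω(X, Y)]` contains a factor vanishing at `p`.
  have hc := Ω.closed X Y Z hX hY hZ p
  rw [extDerivTwo, hXY, hXp, hYp] at hc
  simp only [dirDeriv, hXp, hYp, map_zero, _root_.zero_apply] at hc
  simpa using hc

/-- A smooth field of eigenvectors through a given eigenvector. -/
theorem exists_smoothField_mem_eigenspace {n : ℕ} {ev : Fin n → M → ℝ}
    (hev : ∀ i, SmoothFun (d := d) (ev i)) {p : M} (hinj : Function.Injective fun i ↦ ev i p)
    (htop : ∀ᶠ x in 𝓝 p, ⨆ i, (recursionOperator Ω₁ Ω₂ x).eigenspace (ev i x) = ⊤)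
    {X : Π x : M, TangentSpace (𝓡 d) x} (hX : SmoothField X) {i : Fin n}
    (hXp : X p ∈ (recursionOperator Ω₁ Ω₂ p).eigenspace (ev i p)) :
    ∃ Y : Π x : M, TangentSpace (𝓡 d) x, SmoothField Y ∧ Y p = X p ∧
      ∀ᶠ x in 𝓝 p, Y x ∈ (recursionOperator Ω₁ Ω₂ x).eigenspace (ev i x) := by
  -- The field is `∏_{k ∈ S} (N - λ_k) X`. Each factor kills the pairing with its own eigenspace and
  -- scales `X p` by `λ_i(p) - λ_k(p) ≠ 0`; `c` collects these scalars.
  have key : ∀ S : Finset (Fin n), i ∉ S → ∃ (Y : Π x : M, TangentSpace (𝓡 d) x) (c : ℝ),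
      SmoothField Y ∧ c ≠ 0 ∧ Y p = c • X p ∧
      ∀ x, ∀ j ∈ S, ∀ w ∈ (recursionOperator Ω₁ Ω₂ x).eigenspace (ev j x),
        Ω₁.bilin x (Y x) w = 0 := by
    intro S
    induction S using Finset.induction_on with
    | empty => exact fun _ ↦ ⟨X, 1, hX, one_ne_zero, by simp, by simp⟩
    | insert k S hk ih =>
      intro hi
      obtain ⟨Y, c, hY, hc, hYp, hYS⟩ := ih fun h ↦ hi (Finset.mem_insert_of_mem h)
      have hki : k ≠ i := fun h ↦ hi (h ▸ Finset.mem_insert_self _ _)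
      refine ⟨fun x ↦ recursionOperator Ω₁ Ω₂ x (Y x) - ev k x • Y x, (ev i p - ev k p) * c,
        (hY.recursionOperator Ω₁ Ω₂).sub (hY.smul (hev k)),
        mul_ne_zero (sub_ne_zero.2 (hinj.ne hki.symm)) hc, ?_, ?_⟩
      · simp only [hYp]
        rw [map_smul, Module.End.mem_eigenspace_iff.1 hXp]
        module
      · intro x j hj w hw
        have hN : Ω₁.bilin x (recursionOperator Ω₁ Ω₂ x (Y x) - ev k x • Y x) w =
            (ev j x - ev k x) * Ω₁.bilin x (Y x) w := by
          rw [map_sub, map_smul, LinearMap.sub_apply, LinearMap.smul_apply,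
            recursionOperator_symm, Module.End.mem_eigenspace_iff.1 hw, map_smul, smul_eq_mul,
            smul_eq_mul]
          ring
        rw [hN]
        rcases Finset.mem_insert.1 hj with rfl | hj
        · simp
        · rw [hYS x j hj w hw, mul_zero]
  obtain ⟨Y, c, hY, hc, hYp, hYS⟩ := key (Finset.univ.erase i) (Finset.notMem_erase _ _)
  refine ⟨fun x ↦ c⁻¹ • Y x, hY.smul (SmoothFun.const _), ?_, ?_⟩
  · simp only [hYp]
    rw [smul_smul, inv_mul_cancel₀ hc, one_smul]
  · filter_upwards [htop] with x hx
    refine Submodule.smul_mem _ _ ?_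
    exact mem_eigenspace_of_orthogonal (σ := Ω₁.bilin x) (ev := fun i ↦ ev i x)
      (Ω₁.nondegenerate x) (recursionOperator_symm Ω₁ Ω₂ x) hx
      fun j hj w hw ↦ hYS x j (Finset.mem_erase.2 ⟨hj, Finset.mem_univ _⟩) w hw

variable {Ω₁ Ω₂}

/-- The differential of an eigenvalue is an eigencovector of the recursion operator. -/
theorem MagriCompatible.ham_eigenvalue [T2Space M] (hM : MagriCompatible Ω₁ Ω₂) {n : ℕ}
    {ev : Fin n → M → ℝ} (hev : ∀ i, SmoothFun (d := d) (ev i)) {p : M}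
    (heig : ∀ i, (recursionOperator Ω₁ Ω₂ p).HasEigenvalue (ev i p))
    (hinj : Function.Injective fun i ↦ ev i p)
    (htop : ∀ᶠ x in 𝓝 p, ⨆ i, (recursionOperator Ω₁ Ω₂ x).eigenspace (ev i x) = ⊤) (i : Fin n) :
    Ω₂.ham (ev i) p = ev i p • Ω₁.ham (ev i) p := by
  obtain ⟨a, ha, ha0⟩ := (heig i).exists_hasEigenvector
  obtain ⟨b, hb, hab⟩ := exists_mem_eigenspace_apply_ne_zero (σ := Ω₁.bilin p)
    (ev := fun i ↦ ev i p) (Ω₁.nondegenerate p) (recursionOperator_symm Ω₁ Ω₂ p) hinj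
    htop.self_of_nhds ha ha0
  obtain ⟨g, hg, hga⟩ := exists_smoothFun_diff_eq (d := d) p (Ω₁.flat p a)
  obtain ⟨h, hh, hhb⟩ := exists_smoothFun_diff_eq (d := d) p (Ω₁.flat p b)
  have hga : Ω₁.ham g p = a := by rw [SymplecticForm.ham, hga, Ω₁.sharp_flat]
  have hhb : Ω₁.ham h p = b := by rw [SymplecticForm.ham, hhb, Ω₁.sharp_flat]
  have hsg := Ω₁.smoothField_ham hg
  have hsh := Ω₁.smoothField_ham hh
  have eig : ∀ {x : M} {v : TangentSpace (𝓡 d) x},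
      v ∈ (recursionOperator Ω₁ Ω₂ x).eigenspace (ev i x) →
      recursionOperator Ω₁ Ω₂ x v = ev i x • v := fun hv ↦ Module.End.mem_eigenspace_iff.1 hv
  have hcrit := hM.sharp_diff_bracket hg hh (x := p) (c := ev i p)
    (by rw [← recursionOperator_ham Ω₁, hga, eig ha])
    (by rw [← recursionOperator_ham Ω₁, hhb, eig hb])
  obtain ⟨Y, hY, hYp, hYe⟩ := exists_smoothField_mem_eigenspace Ω₁ Ω₂ hev hinj htop hsg
    (i := i) (by rwa [hga])
  obtain ⟨Z, hZ, hZp, hZe⟩ := exists_smoothField_mem_eigenspace Ω₁ Ω₂ hev hinj htop hsh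
    (i := i) (by rwa [hhb])
  set F : M → ℝ := fun y ↦ bracket Ω₂.sharp g h y - ev i p * bracket Ω₁.sharp g h y
  set B : M → ℝ := bracket Ω₁.sharp g h
  have hB : SmoothFun (d := d) B := Ω₁.smoothFun_bracket hg hh
  have hw := hsh.sub hZ
  have hw' := (hw.recursionOperator Ω₁ Ω₂).sub (hw.smul (hev i))
  have hu := hsg.sub hY
  -- Here `F = ω₁(X_g, (N - c) X_h)` with `c = ev i p`. Writing `N - c = (N - λ_i) + (λ_i - c)`, the
  -- eigenvector fields `Y` and `Z` may be subtracted in the first part, since `N - λ_i` is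
  -- self-adjoint and kills both.
  have hFG : F =ᶠ[𝓝 p] fun x ↦ (ev i x - ev i p) * B x +
      Ω₁.flat x (Ω₁.ham g x - Y x) (recursionOperator Ω₁ Ω₂ x (Ω₁.ham h x - Z x) -
        ev i x • (Ω₁.ham h x - Z x)) := by
    filter_upwards [hYe, hZe] with x hYx hZx
    have h₂ : bracket Ω₂.sharp g h x =
        Ω₁.flat x (Ω₁.ham g x) (recursionOperator Ω₁ Ω₂ x (Ω₁.ham h x)) := by
      rw [recursionOperator_ham, Ω₁.flat_ham]
      rfl
    have h₁ : B x = Ω₁.flat x (Ω₁.ham g x) (Ω₁.ham h x) := by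
      rw [Ω₁.flat_ham]
      rfl
    have hYs := recursionOperator_symm Ω₁ Ω₂ x (Y x) (Ω₁.ham h x)
    rw [eig hYx, map_smul, LinearMap.smul_apply] at hYs
    simp only [SymplecticForm.bilin_apply, smul_eq_mul] at hYs
    simp only [F, h₂]
    change _ - ev i p * B x = _
    rw [h₁, map_sub (recursionOperator Ω₁ Ω₂ x), eig hZx]
    simp only [map_sub, map_smul, _root_.sub_apply, smul_eq_mul, smul_sub]
    linear_combination -hYs
  -- The second summand pairs two fields vanishing at `p`, so only the derivative of `λ_i - c`
  -- contributes.
  have hdF : diff (d := d) F p = B p • diff (ev i) p := by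
    rw [diff_congr hFG, diff_add (((hev i).sub (SmoothFun.const _)).mul hB)
      (Ω₁.smoothFun_flat hu hw'), diff_mul ((hev i).sub (SmoothFun.const _)) hB,
      Ω₁.diff_flat_eq_zero hu hw' (by simp [hYp]) (by simp [hZp])]
    have hs : diff (d := d) (fun y ↦ ev i y - ev i p) p = diff (ev i) p := by
      have := diff_add (hev i) (SmoothFun.const (d := d) (M := M) (-ev i p)) p
      simpa only [diff_const, add_zero, ← sub_eq_add_neg] using this
    rw [hs]
    simp
  have hBp : B p ≠ 0 := by
    have h₁ : B p = Ω₁.flat p (Ω₁.ham g p) (Ω₁.ham h p) := by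
      rw [Ω₁.flat_ham]
      rfl
    rw [h₁, hga, hhb]
    exact hab
  rw [SymplecticForm.ham, SymplecticForm.ham, hdF, map_smul, map_smul, smul_comm] at hcrit
  exact smul_right_injective _ hBp hcrit

end Recursion


/-! ### Trace functions in terms of eigenvalues -/

section TraceFunctions

variable {n : ℕ} {M : Type u} [TopologicalSpace M]
  [ChartedSpace (EuclideanSpace ℝ (Fin (2 * n))) M] [IsManifold (𝓡 (2 * n)) ∞ M]

theorem diff_sum {d : ℕ} [ChartedSpace (EuclideanSpace ℝ (Fin d)) M] [IsManifold (𝓡 d) ∞ M]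
    {ι : Type*} (s : Finset ι) {f : ι → M → ℝ} (hf : ∀ i, SmoothFun (d := d) (f i)) (x : M) :
    SmoothFun (d := d) (fun y ↦ ∑ i ∈ s, f i y) ∧
      diff (d := d) (fun y ↦ ∑ i ∈ s, f i y) x = ∑ i ∈ s, diff (f i) x := by
  classical
  induction s using Finset.induction_on with
  | empty => exact ⟨by simpa using SmoothFun.const 0, by simpa using diff_const 0 x⟩
  | insert i s hi ih =>
    simp only [Finset.sum_insert hi]
    exact ⟨(hf i).add ih.1, by rw [diff_add (hf i) ih.1, ih.2]⟩

theorem SmoothFun.pow {d : ℕ} [ChartedSpace (EuclideanSpace ℝ (Fin d)) M]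
    {f : M → ℝ} (hf : SmoothFun (d := d) f) (k : ℕ) : SmoothFun (d := d) (fun y ↦ f y ^ k) :=
  ContMDiff.pow hf k

theorem diff_pow {d : ℕ} [ChartedSpace (EuclideanSpace ℝ (Fin d)) M] [IsManifold (𝓡 d) ∞ M]
    {f : M → ℝ} (hf : SmoothFun (d := d) f) (k : ℕ) (x : M) :
    diff (d := d) (fun y ↦ f y ^ (k + 1)) x = ((k + 1 : ℝ) * f x ^ k) • diff f x := by
  induction k with
  | zero => simp
  | succ k ih =>
    simp only [pow_succ _ (k + 1)]
    rw [diff_mul (hf.pow (k + 1)) hf, ih]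
    push_cast
    module

theorem smoothFun_of_eventuallyEq {d : ℕ} [ChartedSpace (EuclideanSpace ℝ (Fin d)) M]
    {f : M → ℝ} (h : ∀ p, ∃ g, SmoothFun (d := d) g ∧ f =ᶠ[𝓝 p] g) : SmoothFun (d := d) f := by
  intro p
  obtain ⟨g, hg, hfg⟩ := h p
  exact (hg p).congr_of_eventuallyEq hfg

variable {Ω₁ Ω₂ : SymplecticForm (2 * n) M}

theorem IsRegularPoint.exists_smoothFun [T2Space M] {p : M} (hp : IsRegularPoint n Ω₁ Ω₂ p) :
    ∃ ev : Fin n → M → ℝ, (∀ i, SmoothFun (d := 2 * n) (ev i)) ∧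
      (∀ᶠ x in 𝓝 p, (∀ i, (recursionOperator Ω₁ Ω₂ x).HasEigenvalue (ev i x)) ∧
        Function.Injective fun i ↦ ev i x) ∧
      LinearIndependent ℝ
        (fun i ↦ (diff (ev i) p : TangentSpace (𝓡 (2 * n)) p →L[ℝ] ℝ)) := by
  obtain ⟨U, ev, hU, hpU, hsm, heig, hinj, hli⟩ := hp
  choose g hg hge using fun i ↦ exists_smoothFun_eventuallyEq hU hpU (hsm i)
  refine ⟨g, hg, ?_, ?_⟩
  · filter_upwards [hU.mem_nhds hpU, eventually_all.2 hge] with x hx hgx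
    simp only [hgx]
    exact ⟨heig x hx, hinj x hx⟩
  · simpa only [diff_congr (hge _)] using hli

/-- The case `k = 0` is harmless: `1 / 0 = 0` makes both sides vanish. -/
theorem traceFun_eq {x : M} {ev : Fin n → ℝ}
    (hev : ∀ i, (recursionOperator Ω₁ Ω₂ x).HasEigenvalue (ev i)) (hinj : Function.Injective ev)
    (k : ℕ) : traceFun Ω₁ Ω₂ k x = (1 / (k : ℝ)) * (2 * ∑ i, ev i ^ k) := by
  rw [traceFun, trace_pow_eq (σ := Ω₁.bilin x) (Ω₁.alternating x) (Ω₁.nondegenerate x)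
    (recursionOperator_symm Ω₁ Ω₂ x) (finrank_tangentSpace x) hev hinj]

theorem smoothFun_traceFun [T2Space M] (hreg : ∀ p : M, IsRegularPoint n Ω₁ Ω₂ p) (k : ℕ) :
    SmoothFun (d := 2 * n) (traceFun Ω₁ Ω₂ k) := by
  refine smoothFun_of_eventuallyEq fun p ↦ ?_
  obtain ⟨ev, hev, hx, -⟩ := (hreg p).exists_smoothFun
  refine ⟨fun x ↦ (1 / (k : ℝ)) * (2 * ∑ i, ev i x ^ k), (SmoothFun.const _).mul
    ((SmoothFun.const _).mul (diff_sum _ (fun i ↦ (hev i).pow k) p).1), ?_⟩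
  filter_upwards [hx] with x hx
  exact traceFun_eq hx.1 hx.2 k

/-- The differentials of the eigenvalues at a regular point. -/
theorem MagriCompatible.exists_eigenvalue_differentials [T2Space M]
    (hM : MagriCompatible Ω₁ Ω₂) {p : M} (hp : IsRegularPoint n Ω₁ Ω₂ p) :
    ∃ (l : Fin n → ℝ) (δ : Fin n → TangentSpace (𝓡 (2 * n)) p →L[ℝ] ℝ),
      Function.Injective l ∧ LinearIndependent ℝ δ ∧
      (∀ i, Ω₂.sharp p (δ i) = l i • Ω₁.sharp p (δ i)) ∧
      ∀ k : ℕ, diff (traceFun Ω₁ Ω₂ (k + 1)) p = (2 : ℝ) • ∑ i, l i ^ k • δ i := by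
  obtain ⟨ev, hev, hx, hli⟩ := hp.exists_smoothFun
  refine ⟨fun i ↦ ev i p, fun i ↦ diff (ev i) p, hx.self_of_nhds.2, hli, fun i ↦ ?_, fun k ↦ ?_⟩
  · refine hM.ham_eigenvalue hev hx.self_of_nhds.1 hx.self_of_nhds.2 ?_ i
    filter_upwards [hx] with x hx
    exact (finrank_eigenspace_and_iSup (σ := Ω₁.bilin x) (Ω₁.alternating x) (Ω₁.nondegenerate x)
      (recursionOperator_symm Ω₁ Ω₂ x) (finrank_tangentSpace x) hx.1 hx.2).2
  · have heq : traceFun Ω₁ Ω₂ (k + 1) =ᶠ[𝓝 p]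
        fun x ↦ (2 / ((k + 1 : ℕ) : ℝ)) * ∑ i, ev i x ^ (k + 1) := by
      filter_upwards [hx] with x hx
      rw [traceFun_eq hx.1 hx.2]
      ring
    have hs := diff_sum Finset.univ (fun i ↦ (hev i).pow (k + 1)) p
    have hk : (k : ℝ) + 1 ≠ 0 := by positivity
    rw [diff_congr heq, diff_const_mul _ hs.1, hs.2, Finset.smul_sum, Finset.smul_sum]
    refine Finset.sum_congr rfl fun i _ ↦ ?_
    rw [diff_pow (hev i), smul_smul, smul_smul]
    congr 1
    push_cast
    field_simp

end TraceFunctions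

/-! ### The bi-Lagrangian distribution and its Bott connections -/

section Distribution

variable {n : ℕ} {M : Type u} [TopologicalSpace M]
  [ChartedSpace (EuclideanSpace ℝ (Fin (2 * n))) M] [IsManifold (𝓡 (2 * n)) ∞ M]
  {Ω₁ Ω₂ : SymplecticForm (2 * n) M}

/-- In a vanishing combination, the coefficient of `δ i` is twice the value at `l i` of a polynomial
of degree less than `n`; vanishing at `n` distinct nodes forces it to be zero. -/
theorem linearIndependent_sum_pow_smul {V : Type*} [AddCommGroup V] [Module ℝ V] {l : Fin n → ℝ}
    (hl : Function.Injective l) {δ : Fin n → V} (hδ : LinearIndependent ℝ δ) :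
    LinearIndependent ℝ fun k : Fin n ↦ (2 : ℝ) • ∑ i, l i ^ (k : ℕ) • δ i := by
  rw [Fintype.linearIndependent_iff]
  intro c hc
  have h : ∑ i, (2 * ∑ k : Fin n, c k * l i ^ (k : ℕ)) • δ i = 0 := by
    rw [← hc]
    simp only [Finset.smul_sum, Finset.mul_sum, Finset.sum_smul, smul_smul]
    rw [Finset.sum_comm]
    refine Finset.sum_congr rfl fun k _ ↦ Finset.sum_congr rfl fun i _ ↦ ?_
    congr 1
    ring
  have h' := Fintype.linearIndependent_iff.1 hδ _ h
  have h0 : c = 0 := Matrix.eq_zero_of_forall_index_sum_mul_pow_eq_zero hl fun i ↦ by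
    have := h' i
    simpa using this
  exact congrFun h0

/-- The transposed Vandermonde system recovers the numbers `δ i v` from their first `n`
power-weighted sums. -/
theorem mem_traceDistribution_iff {p : M} {l : Fin n → ℝ}
    {δ : Fin n → TangentSpace (𝓡 (2 * n)) p →L[ℝ] ℝ} (hl : Function.Injective l)
    (hI : ∀ k : ℕ, diff (traceFun Ω₁ Ω₂ (k + 1)) p = (2 : ℝ) • ∑ i, l i ^ k • δ i)
    {v : TangentSpace (𝓡 (2 * n)) p} :
    v ∈ traceDistribution n Ω₁ Ω₂ p ↔ ∀ i, δ i v = 0 := by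
  have hv : ∀ k : ℕ, diff (traceFun Ω₁ Ω₂ (k + 1)) p v = 2 * ∑ i, l i ^ k * δ i v := by
    intro k
    rw [hI]
    simp [_root_.sum_apply]
  rw [traceDistribution, Submodule.mem_iInf]
  refine ⟨fun h ↦ ?_, fun h k ↦ ?_⟩
  · have h0 : (fun i ↦ δ i v) = 0 := Matrix.eq_zero_of_forall_pow_sum_mul_pow_eq_zero hl fun k ↦ by
      have h' : diff (traceFun Ω₁ Ω₂ (k + 1)) p v = 0 := h k
      rw [hv] at h'
      simpa [mul_comm] using h'
    exact congrFun h0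
  · change diff (traceFun Ω₁ Ω₂ (k + 1)) p v = 0
    rw [hv]
    simp [h]

/-- The common kernel of `n` independent covectors in involution is Lagrangian. -/
theorem SymplecticForm.lagrangian_of_involution (Ω : SymplecticForm (2 * n) M) {p : M}
    {δ : Fin n → TangentSpace (𝓡 (2 * n)) p →L[ℝ] ℝ} (hδ : LinearIndependent ℝ δ)
    (hinv : ∀ i j, δ i (Ω.sharp p (δ j)) = 0) (v : TangentSpace (𝓡 (2 * n)) p) :
    (∀ i, δ i v = 0) ↔ ∀ w, (∀ i, δ i w = 0) → Ω.flat p v w = 0 := by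
  have hsharp : ∀ i w, Ω.flat p (Ω.sharp p (δ i)) w = δ i w := fun i w ↦ by rw [Ω.flat_sharp]
  refine ⟨fun hv w hw ↦ ?_, fun h i ↦ ?_⟩
  · let f : Fin n → Module.Dual ℝ (TangentSpace (𝓡 (2 * n)) p) := fun i ↦ (δ i).toLinearMap
    have hf : LinearIndependent ℝ f := hδ.map' (ContinuousLinearMap.coeLM ℝ)
      (LinearMap.ker_eq_bot.2 ContinuousLinearMap.coe_injective)
    let K := (Submodule.span ℝ (Set.range f)).dualCoannihilator
    have hK : ∀ u, u ∈ K ↔ ∀ i, δ i u = 0 := by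
      intro u
      rw [← SetLike.mem_coe, Submodule.coe_dualCoannihilator_span]
      simp [f]
    have hKrank : Module.finrank ℝ K = n := by
      have h := Subspace.finrank_add_finrank_dualCoannihilator_eq (Submodule.span ℝ (Set.range f))
      rw [finrank_span_eq_card hf, finrank_tangentSpace, Fintype.card_fin] at h
      change n + Module.finrank ℝ K = 2 * n at h
      omega
    -- The vectors `Ω♯ δ_i` lie in `K` by involution; being `n` independent vectors in an
    -- `n`-dimensional space, they span it.
    let s : Fin n → TangentSpace (𝓡 (2 * n)) p := fun i ↦ Ω.sharp p (δ i)
    have hs : LinearIndependent ℝ s := by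
      obtain ⟨e, -, he⟩ := Ω.exists_equiv p
      refine hδ.map' (Ω.sharp p).toLinearMap (LinearMap.ker_eq_bot.2 ?_)
      rw [← he]
      exact e.symm.injective
    have hsK : Submodule.span ℝ (Set.range s) ≤ K := by
      rw [Submodule.span_le]
      rintro _ ⟨j, rfl⟩
      exact (hK _).2 fun i ↦ hinv i j
    have heq : Submodule.span ℝ (Set.range s) = K :=
      Submodule.eq_of_le_of_finrank_eq hsK (by
        rw [finrank_span_eq_card hs, hKrank, Fintype.card_fin])
    have hvs : v ∈ Submodule.span ℝ (Set.range s) := heq ▸ (hK v).2 hv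
    have hle : Submodule.span ℝ (Set.range s) ≤
        LinearMap.ker (LinearMap.flip (Ω.bilin p) w) := by
      rw [Submodule.span_le]
      rintro _ ⟨j, rfl⟩
      exact (hsharp j w).trans (hw j)
    exact hle hvs
  · have h' := h (Ω.sharp p (δ i)) fun j ↦ hinv j i
    rwa [Ω.flat_neg, hsharp, neg_eq_zero] at h'

/-- Skew-symmetry of both tensors gives `l j * a = l i * a` for the pairing `a`, hence `a = 0` when
`i ≠ j`; the diagonal case is skew-symmetry alone. -/
theorem apply_sharp_eq_zero {p : M} {l : Fin n → ℝ}
    {δ : Fin n → TangentSpace (𝓡 (2 * n)) p →L[ℝ] ℝ} (hl : Function.Injective l)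
    (hsharp : ∀ i, Ω₂.sharp p (δ i) = l i • Ω₁.sharp p (δ i)) (i j : Fin n) :
    δ i (Ω₁.sharp p (δ j)) = 0 := by
  have skew : ∀ (Ω : SymplecticForm (2 * n) M) (i j : Fin n),
      δ i (Ω.sharp p (δ j)) = -δ j (Ω.sharp p (δ i)) := by
    intro Ω i j
    have h := Ω.flat_neg p (Ω.sharp p (δ i)) (Ω.sharp p (δ j))
    rwa [Ω.flat_sharp, Ω.flat_sharp] at h
  have h₁ := skew Ω₁ i j
  have h₂ := skew Ω₂ i j
  rw [hsharp, hsharp, map_smul, map_smul, smul_eq_mul, smul_eq_mul] at h₂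
  rcases eq_or_ne i j with rfl | hij
  · linarith
  · have h : (l i - l j) * δ i (Ω₁.sharp p (δ j)) = 0 := by
      linear_combination l i * h₁ - h₂
    exact (mul_eq_zero.1 h).resolve_left (sub_ne_zero.2 (hl.ne hij))

theorem MagriCompatible.isLagrangian [T2Space M] (hM : MagriCompatible Ω₁ Ω₂)
    (hreg : ∀ p : M, IsRegularPoint n Ω₁ Ω₂ p) :
    IsLagrangian Ω₁ (traceDistribution n Ω₁ Ω₂) ∧ IsLagrangian Ω₂ (traceDistribution n Ω₁ Ω₂) := by
  refine ⟨fun p v ↦ ?_, fun p v ↦ ?_⟩ <;>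
  · obtain ⟨l, δ, hl, hδ, hs, hI⟩ := hM.exists_eigenvalue_differentials (hreg p)
    simp only [mem_traceDistribution_iff hl hI]
    refine SymplecticForm.lagrangian_of_involution _ hδ (fun i j ↦ ?_) v
    simp [hs, apply_sharp_eq_zero hl hs]

theorem MagriCompatible.linearIndependent_diff_traceFun [T2Space M] (hM : MagriCompatible Ω₁ Ω₂)
    {p : M} (hp : IsRegularPoint n Ω₁ Ω₂ p) :
    LinearIndependent ℝ (fun k : Fin n ↦
      (diff (traceFun Ω₁ Ω₂ (k + 1)) p : TangentSpace (𝓡 (2 * n)) p →L[ℝ] ℝ)) := by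
  obtain ⟨l, δ, hl, hδ, -, hI⟩ := hM.exists_eigenvalue_differentials hp
  simpa only [hI] using linearIndependent_sum_pow_smul hl hδ

/-- All the trace functions are constant along the distribution. -/
theorem MagriCompatible.diff_traceFun_apply_eq_zero [T2Space M] (hM : MagriCompatible Ω₁ Ω₂) {p : M}
    (hp : IsRegularPoint n Ω₁ Ω₂ p) {v : TangentSpace (𝓡 (2 * n)) p}
    (hv : v ∈ traceDistribution n Ω₁ Ω₂ p) (k : ℕ) : diff (traceFun Ω₁ Ω₂ (k + 1)) p v = 0 := by
  obtain ⟨l, δ, hl, -, -, hI⟩ := hM.exists_eigenvalue_differentials hp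
  rw [mem_traceDistribution_iff hl hI] at hv
  rw [hI]
  simp [_root_.sum_apply, hv]

/-- The Lenard recursion `dI_k ∘ N = dI_{k + 1}`. -/
theorem MagriCompatible.diff_traceFun_recursionOperator [T2Space M] (hM : MagriCompatible Ω₁ Ω₂)
    {p : M} (hp : IsRegularPoint n Ω₁ Ω₂ p) (v : TangentSpace (𝓡 (2 * n)) p) (k : ℕ) :
    diff (traceFun Ω₁ Ω₂ (k + 1)) p (recursionOperator Ω₁ Ω₂ p v) =
      diff (traceFun Ω₁ Ω₂ (k + 2)) p v := by
  obtain ⟨l, δ, -, -, hs, hI⟩ := hM.exists_eigenvalue_differentials hp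
  have hδN : ∀ i, δ i (recursionOperator Ω₁ Ω₂ p v) = l i * δ i v := by
    intro i
    have h₁ : Ω₂.flat p (Ω₂.sharp p (δ i)) (recursionOperator Ω₁ Ω₂ p v) =
        δ i (recursionOperator Ω₁ Ω₂ p v) := by rw [Ω₂.flat_sharp]
    rw [← h₁, flat_recursionOperator_right, hs, map_smul, _root_.smul_apply, Ω₁.flat_sharp,
      smul_eq_mul]
  rw [hI, hI (k + 1)]
  simp only [_root_.smul_apply, _root_.sum_apply, smul_eq_mul, hδN, pow_succ, mul_assoc]

theorem IsSectionOf.dirDeriv_traceFun [T2Space M] (hM : MagriCompatible Ω₁ Ω₂)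
    (hreg : ∀ p : M, IsRegularPoint n Ω₁ Ω₂ p) {X : Π x : M, TangentSpace (𝓡 (2 * n)) x}
    (hX : IsSectionOf (traceDistribution n Ω₁ Ω₂) X) (k : ℕ) :
    dirDeriv X (traceFun Ω₁ Ω₂ (k + 1)) = fun _ ↦ 0 :=
  funext fun p ↦ hM.diff_traceFun_apply_eq_zero (hreg p) (hX.2 p) k

theorem MagriCompatible.isInvolutive [T2Space M] (hM : MagriCompatible Ω₁ Ω₂)
    (hreg : ∀ p : M, IsRegularPoint n Ω₁ Ω₂ p) :
    IsInvolutive (traceDistribution n Ω₁ Ω₂) := by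
  intro X Y hX hY p
  rw [traceDistribution, Submodule.mem_iInf]
  intro k
  change diff (traceFun Ω₁ Ω₂ (k + 1)) p _ = 0
  rw [diff_mlieBracket hX.1 hY.1 (smoothFun_traceFun hreg _), hX.dirDeriv_traceFun hM hreg,
    hY.dirDeriv_traceFun hM hreg]
  simp [dirDeriv, diff_const]

/-- The recursion operator is invariant along the distribution, up to the distribution. -/
theorem MagriCompatible.mlieBracket_recursionOperator_mem [T2Space M]
    (hM : MagriCompatible Ω₁ Ω₂) (hreg : ∀ p : M, IsRegularPoint n Ω₁ Ω₂ p)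
    {X Z : Π x : M, TangentSpace (𝓡 (2 * n)) x}
    (hX : IsSectionOf (traceDistribution n Ω₁ Ω₂) X) (hZ : SmoothField Z) (p : M) :
    VectorField.mlieBracket (𝓡 (2 * n)) X (fun x ↦ recursionOperator Ω₁ Ω₂ x (Z x)) p -
      recursionOperator Ω₁ Ω₂ p (VectorField.mlieBracket (𝓡 (2 * n)) X Z p) ∈
        traceDistribution n Ω₁ Ω₂ p := by
  rw [traceDistribution, Submodule.mem_iInf]
  intro k
  change diff (traceFun Ω₁ Ω₂ (k + 1)) p _ = 0
  -- The recursion can reach `I_{n+1}`, which is not among the functions defining the distribution;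
  -- it is still constant along it, because `dI_{n+1}` is a combination of the `dλ_i`.
  have hNZ : dirDeriv (fun x ↦ recursionOperator Ω₁ Ω₂ x (Z x)) (traceFun Ω₁ Ω₂ (k + 1)) =
      dirDeriv Z (traceFun Ω₁ Ω₂ (k + 2)) :=
    funext fun x ↦ hM.diff_traceFun_recursionOperator (hreg x) (Z x) k
  rw [map_sub, hM.diff_traceFun_recursionOperator (hreg p),
    diff_mlieBracket hX.1 (hZ.recursionOperator Ω₁ Ω₂) (smoothFun_traceFun hreg _),
    diff_mlieBracket hX.1 hZ (smoothFun_traceFun hreg _), hX.dirDeriv_traceFun hM hreg, hNZ,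
    hX.dirDeriv_traceFun hM hreg]
  simp [dirDeriv, diff_const]

theorem MagriCompatible.bottConnectionsCoincide [T2Space M] (hM : MagriCompatible Ω₁ Ω₂)
    (hreg : ∀ p : M, IsRegularPoint n Ω₁ Ω₂ p) :
    BottConnectionsCoincide Ω₁ Ω₂ (traceDistribution n Ω₁ Ω₂) := by
  intro X Y hX hY
  funext p
  set α₁ := lieDeriv X (fun y ↦ Ω₁.flat y (Y y)) p with hα₁
  set α₂ := lieDeriv X (fun y ↦ Ω₂.flat y (Y y)) p with hα₂
  -- Both Lie derivatives share the term `X[ω₁(Y, Z)] = X[ω₂(Y, NZ)]`; the remaining difference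
  -- pairs `Y` with a vector of the Lagrangian distribution.
  have key : ∀ v, α₁ v = α₂ (recursionOperator Ω₁ Ω₂ p v) := by
    intro v
    obtain ⟨Z, hZ, rfl⟩ := exists_smoothField_eq v
    have h₁ := lieDeriv_apply hX.1 (Ω₁.smoothOneForm_flat hY.1) hZ p
    have h₂ := lieDeriv_apply hX.1 (Ω₂.smoothOneForm_flat hY.1) (hZ.recursionOperator Ω₁ Ω₂) p
    simp only [flat_recursionOperator_right] at h₂
    rw [hα₁, hα₂, h₁, h₂, ← flat_recursionOperator_right Ω₁ Ω₂ p]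
    have h := ((hM.isLagrangian hreg).2 p (Y p)).1 (hY.2 p) _
      (hM.mlieBracket_recursionOperator_mem hreg hX hZ p)
    rw [map_sub] at h
    linarith
  have hflat : α₁ = Ω₁.flat p (Ω₂.sharp p α₂) := by
    ext v
    rw [key, Ω₁.flat_neg, ← flat_recursionOperator_left Ω₁ Ω₂, ← Ω₂.flat_neg, Ω₂.flat_sharp]
  change Ω₁.sharp p α₁ = Ω₂.sharp p α₂
  rw [hflat, Ω₁.sharp_flat]

end Distribution

end BiHam

open BiHam in
theorem theorem5p1 {n : ℕ} {M : Type u} [TopologicalSpace M]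
    [ChartedSpace (EuclideanSpace ℝ (Fin (2 * n))) M] [IsManifold (𝓡 (2 * n)) ∞ M]
    [T2Space M] [SecondCountableTopology M]
    (ω₁ ω₂ : SymplecticForm (2 * n) M) (hMagri : MagriCompatible ω₁ ω₂)
    (hreg : ∀ p : M, IsRegularPoint n ω₁ ω₂ p) :
    -- the `I_k` are functionally independent and define a bi-Lagrangian foliation
    (∀ x : M, LinearIndependent ℝ (fun k : Fin n ↦
        (diff (traceFun ω₁ ω₂ (k + 1)) x : TangentSpace (𝓡 (2 * n)) x →L[ℝ] ℝ))) ∧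
    IsInvolutive (traceDistribution n ω₁ ω₂) ∧
    IsLagrangian ω₁ (traceDistribution n ω₁ ω₂) ∧
    IsLagrangian ω₂ (traceDistribution n ω₁ ω₂) ∧
    -- the Bott connections in the associated distribution coincide
    BottConnectionsCoincide ω₁ ω₂ (traceDistribution n ω₁ ω₂) ∧
    -- and, if the foliation is a fibration with compact connected fibers,
    -- the two forms are bi-affinely compatible, by means of every such fibration
    (∀ (B : Type v) [TopologicalSpace B] [ChartedSpace (EuclideanSpace ℝ (Fin n)) B]
        [IsManifold (𝓡 n) ∞ B] [T2Space B] [SecondCountableTopology B] (pr : M → B),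
      IsCompactConnectedFibration (n := n) pr →
      (∀ x, verticalDistribution (n := n) pr x = traceDistribution n ω₁ ω₂ x) →
      IsPiCompatible ω₁ ω₂ pr ∧ BiAffinelyCompatible.{u, v} ω₁ ω₂) := by

  refine ⟨fun x ↦ hMagri.linearIndependent_diff_traceFun (hreg x), hMagri.isInvolutive hreg,
    (hMagri.isLagrangian hreg).1, (hMagri.isLagrangian hreg).2,
    hMagri.bottConnectionsCoincide hreg, ?_⟩
  intro B _ _ _ _ _ pr hpr hL
  have hL' : verticalDistribution (n := n) pr = traceDistribution n ω₁ ω₂ := funext hL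
  have hpi : IsPiCompatible ω₁ ω₂ pr :=
    ⟨hpr, hL' ▸ (hMagri.isLagrangian hreg).1, hL' ▸ (hMagri.isLagrangian hreg).2,
      hL' ▸ hMagri.bottConnectionsCoincide hreg⟩
  exact ⟨hpi, B, _, _, inferInstance, inferInstance, inferInstance, pr, hpi⟩
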